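/- Let $n\in\mathbb N$ and $\vec p=(p_1,\dots,p_n)\in(1,2]^n$. There is a constant $c=c(\vec p)>0$, depending only on $\vec p$ (and thus on $n$), with the following property. Let $\vec\gamma=(\gamma_1,\dots,\gamma_n)\in[0,\infty)^n$, let $\alpha,\beta>0$, and let $u\in C([0,\infty);L^2(\mathbb R^n))$ be the solution, in the sense of tempered distributions, of the free Schrödinger equation $\partial_t u=i\Delta u$, $t>0$, with initial value $u(0)\in L^2(\mathbb R^n)$. Write $$\widehat f(\xi)=(2\pi)^{-n/2}\int_{\mathbb R^n}e^{-ix\cdot\xi}f(x)\,dx,\qquad \theta(t)=\frac{\beta(T-t)}{T(\alpha t+\beta)},\qquad \mu(t)=\frac{\beta}{\alpha t+\beta},$$ where the Fourier transform is extended to $L^2(\mathbb R^n)$ by Plancherel's theorem. Then for every $T>0$ and $0\le t\le T$, $$\Big\|e^{\sum_{j}\gamma_j\left|\frac{x_j}{\alpha t+\beta}\right|^{p_j}}u(t)\Big\|_2\le c\,\Big\|e^{\sum_{j}\gamma_j\left|\frac{x_j}{\beta}\right|^{p_j}}u(0)\Big\|_2^{\theta(t)}\,\Big\|e^{\sum_{j}\gamma_j\left|\frac{x_j}{\alpha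 T+\beta}\right|^{p_j}}u(T)\Big\|_2^{1-\theta(t)},$$ and for every $t\ge 0$, $$\Big\|e^{\sum_{j}\gamma_j\left|\frac{x_j}{\alpha t+\beta}\right|^{p_j}}u(t)\Big\|_2\le c\,\Big\|e^{\sum_{j}\gamma_j\left|\frac{x_j}{\beta}\right|^{p_j}}u(0)\Big\|_2^{\mu(t)}\,\Big\|e^{\sum_{j}\gamma_j\left|\frac{2\xi_j}{\alpha}\right|^{p_j}}\widehat{u(0)}\Big\|_2^{1-\mu(t)}.$$ Here the sums run over $1\le j\le n$, and the norms are taken in $[0,\infty]$ (with $a^0=1$ for all $a\in[0,\infty]$), so that in each inequality the left-hand side is finite whenever the right-hand side is. -/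

import Mathlib

open MeasureTheory FourierTransform
open scoped SchwartzMap Laplacian ENNReal

noncomputable section

/-- The complex Hilbert space `L²(ℝⁿ)` with respect to Lebesgue measure. -/
abbrev L2Space (n : ℕ) : Type := Lp (α := EuclideanSpace ℝ (Fin n)) ℂ 2

/-- `u ∈ C([0,∞); L²(ℝⁿ))` is the solution of the free Schrödinger equation `∂ₜ u = i Δ u`, `t > 0`,
with initial value `u 0`: the equation holds in the sense of tempered distributions, i.e. for every
Schwartz function `φ`, `d/dt ⟨u(t), φ⟩ = i ⟨Δ u(t), φ⟩`, where `⟨f, φ⟩ = ∫ f φ` (no conjugation)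
and `Δ` is the distributional Laplacian. -/
structure IsFreeSchrodingerSolution {n : ℕ} (u : ℝ → L2Space n) : Prop where
  continuousOn : ContinuousOn u (Set.Ici 0)
  hasDerivAt : ∀ t : ℝ, 0 < t → ∀ φ : 𝓢(EuclideanSpace ℝ (Fin n), ℂ),
    HasDerivAt (fun s : ℝ => Lp.toTemperedDistribution (u s) φ)
      (Complex.I * (Δ (Lp.toTemperedDistribution (u t))) φ) t

/-- The Fourier transform on `L²(ℝⁿ)` in the normalisation
`f̂(ξ) = (2π)^(-n/2) ∫ exp(-i x·ξ) f(x) dx` (extended from the Schwartz functions by Plancherel).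
Mathlib's `𝓕 f (η)` is the extension of `∫ exp(-2πi x·η) f(x) dx`. -/
def fourierHat {n : ℕ} (f : L2Space n) (ξ : EuclideanSpace ℝ (Fin n)) : ℂ :=
  (((2 * Real.pi) ^ (-(n : ℝ) / 2) : ℝ) : ℂ) * (𝓕 f : L2Space n) ((2 * Real.pi)⁻¹ • ξ)

/-- The weight `exp (∑ⱼ γⱼ |yⱼ|^{pⱼ})`. -/
def expWeight {n : ℕ} (γ p : Fin n → ℝ) (y : EuclideanSpace ℝ (Fin n)) : ℝ :=
  Real.exp (∑ j, γ j * |y j| ^ p j)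

/-- The weighted norm `‖exp (∑ⱼ γⱼ |s xⱼ|^{pⱼ}) f‖₂`, with values in `[0, ∞]`. -/
def weightedNorm {n : ℕ} (γ p : Fin n → ℝ) (s : ℝ) (f : EuclideanSpace ℝ (Fin n) → ℂ) : ℝ≥0∞ :=
  eLpNorm (fun x => (expWeight γ p (s • x) : ℂ) * f x) 2 volume

/-- The exponent `θ(t) = β (T - t) / (T (α t + β))`. -/
def thetaExp (α β T t : ℝ) : ℝ := β * (T - t) / (T * (α * t + β))

/-- The exponent `μ(t) = β / (α t + β)`. -/
def muExp (α β t : ℝ) : ℝ := β / (α * t + β)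

end

open Matrix Module
open scoped Real

/-!
Put `v = exp (-i (β/α) Δ) u(0)`. Up to a unimodular factor and a dilation, `exp (i s Δ) v` is the
Fourier transform of the chirped function `exp (i |x|² / (4 s)) v`. The dilation turns the weights
of the theorem at the times `0`, `t`, `T` into one and the same weight; the transform `û(0)`
corresponds to the chirp parameter `0` (`s = ∞`), and the exponents `θ(t)`, `μ(t)` say that the
chirp parameters `σ` are in convex position. So it is enough to show that, up to a constant,
`σ ↦ ‖w 𝓕 (exp (i σ |x|²) v)‖₂` is logarithmically convex.

For `w = exp (l · x)`, the weight translates `exp (i σ |x|²) v` by an imaginary multiple of `l`.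
Complex translation turns the chirp into itself times `exp (-σ l · x / π)`, up to a constant of
modulus one, which is the exponential of a function linear in `σ`, so that Hölder's inequality
applies. As no analyticity of `v` is available, complex translates are defined weakly, by pairing
with Gaussians `exp (-a |x|² + b · x)`, `b ∈ ℂⁿ`.

For `1 < p ≤ 2` the weight `exp (|y|^p)` is comparable to a superposition of the exponentials
`exp (l y)`: integrate the exponentials of the tangents of `|y|^p` with respect to the parameter
`s = sign y |y|^(p/2)`, in which the distance of `|y|^p` from its tangent is comparable to the
square of the distance from the point of tangency.
-/

section Gaussian

variable {n : ℕ}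

/-- The complex Gaussian `exp (-a |x|² + b · x)` of width parameter `a` and drift `b`. The Gaussians
with `0 < a.re` are the test functions of the whole argument: the drift `b` ranges over `ℂⁿ`, so
that they are stable under Fourier transforms, chirps and translations by complex vectors. -/
noncomputable def gauss (a : ℂ) (b : Fin n → ℂ) (x : EuclideanSpace ℝ (Fin n)) : ℂ :=
  Complex.exp (-a * ‖x‖ ^ 2 + ∑ i, b i * x i)

/-- The bilinear pairing (no conjugation) of `f` with a complex Gaussian. -/
noncomputable def gaussPair (f : EuclideanSpace ℝ (Fin n) → ℂ) (a : ℂ) (b : Fin n → ℂ) : ℂ :=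
  ∫ x, gauss a b x * f x

@[fun_prop]
lemma continuous_gauss (a : ℂ) (b : Fin n → ℂ) : Continuous (gauss a b) := by
  unfold gauss; fun_prop

lemma gauss_ne_zero (a : ℂ) (b : Fin n → ℂ) (x : EuclideanSpace ℝ (Fin n)) : gauss a b x ≠ 0 :=
  Complex.exp_ne_zero _

lemma gauss_add (a a' : ℂ) (b b' : Fin n → ℂ) (x : EuclideanSpace ℝ (Fin n)) :
    gauss (a + a') (b + b') x = gauss a b x * gauss a' b' x := by
  simp only [gauss, ← Complex.exp_add, Pi.add_apply, add_mul, Finset.sum_add_distrib]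
  ring_nf

lemma norm_gauss (a : ℂ) (b : Fin n → ℂ) (x : EuclideanSpace ℝ (Fin n)) :
    ‖gauss a b x‖ = Real.exp (-a.re * ‖x‖ ^ 2 + ∑ i, (b i).re * x i) := by
  rw [gauss, Complex.norm_exp, Complex.add_re, Complex.re_sum, ← Complex.ofReal_pow,
    Complex.re_mul_ofReal, Complex.neg_re]
  simp only [Complex.re_mul_ofReal]

lemma gauss_smul (a : ℂ) (b : Fin n → ℂ) (ρ : ℝ) (x : EuclideanSpace ℝ (Fin n)) :
    gauss a b (ρ • x) = gauss (ρ ^ 2 * a) ((ρ : ℂ) • b) x := by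
  simp only [gauss, norm_smul, Real.norm_eq_abs, ← Complex.ofReal_pow, mul_pow, sq_abs,
    PiLp.smul_apply, Pi.smul_apply, smul_eq_mul, Complex.ofReal_mul]
  congr 2
  · ring
  · exact Finset.sum_congr rfl fun i _ => by ring

lemma gauss_toLp (a : ℂ) (b : Fin n → ℂ) (x : Fin n → ℝ) :
    gauss a b (WithLp.toLp 2 x) = Complex.exp (-a * ∑ i, (x i : ℂ) ^ 2 + ∑ i, b i * x i) := by
  simp only [gauss, ← Complex.ofReal_pow, EuclideanSpace.real_norm_sq_eq, Complex.ofReal_sum]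

lemma integrable_gauss {a : ℂ} (ha : 0 < a.re) (b : Fin n → ℂ) : Integrable (gauss a b) := by
  rw [← (PiLp.volume_preserving_toLp (Fin n)).integrable_comp_emb
    (MeasurableEquiv.toLp 2 _).measurableEmbedding]
  exact (GaussianFourier.integrable_cexp_neg_mul_sum_add ha b).congr
    (.of_forall fun x => (gauss_toLp a b x).symm)

lemma integral_gauss {a : ℂ} (ha : 0 < a.re) (b : Fin n → ℂ) :
    ∫ x, gauss a b x = (π / a) ^ ((n : ℂ) / 2) * Complex.exp (b ⬝ᵥ b / (4 * a)) := by
  rw [← (PiLp.volume_preserving_toLp (Fin n)).integral_comp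
    (MeasurableEquiv.toLp 2 _).measurableEmbedding]
  simpa [gauss_toLp, dotProduct, ← sq] using GaussianFourier.integral_cexp_neg_mul_sum_add ha b

lemma memLp_gauss {a : ℂ} (ha : 0 < a.re) (b : Fin n → ℂ) : MemLp (gauss a b) 2 := by
  rw [memLp_two_iff_integrable_sq_norm (continuous_gauss a b).aestronglyMeasurable]
  refine (integrable_gauss (a := a + a) (by simpa using ha) (b + b)).norm.congr
    (.of_forall fun x => ?_)
  simp only [gauss_add, norm_mul, sq]

lemma fourierChar_smul_gauss (a : ℂ) (b : Fin n → ℂ) (v ξ : EuclideanSpace ℝ (Fin n)) :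
    Complex.exp (((-2 * π * inner ℝ v ξ : ℝ) : ℂ) * Complex.I) • gauss a b v =
      gauss a (b - (2 * π * Complex.I) • fun i => (ξ i : ℂ)) v := by
  simp only [gauss, smul_eq_mul, ← Complex.exp_add, PiLp.inner_apply, RCLike.inner_apply,
    conj_trivial, Pi.sub_apply, Pi.smul_apply, sub_mul, Finset.sum_sub_distrib]
  push_cast
  rw [Finset.mul_sum, Finset.sum_mul, add_left_comm, sub_eq_add_neg, ← Finset.sum_neg_distrib,
    add_comm (∑ i, b i * _)]
  congr 3
  exact Finset.sum_congr rfl fun i _ => by ring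

lemma fourier_gauss {a : ℂ} (ha : 0 < a.re) (b : Fin n → ℂ) :
    𝓕 (gauss a b) = ((π / a) ^ ((n : ℂ) / 2) * Complex.exp (b ⬝ᵥ b / (4 * a))) •
      gauss (π ^ 2 / a) (-(π * Complex.I / a) • b) := by
  have ha0 : a ≠ 0 := by rintro rfl; simp at ha
  ext ξ
  simp only [Real.fourier_eq', fourierChar_smul_gauss, integral_gauss ha]
  rw [Pi.smul_apply, smul_eq_mul, gauss, mul_assoc (_ ^ _), ← Complex.exp_add]
  congr 2
  have hξ : (fun i => (ξ i : ℂ)) ⬝ᵥ (fun i => (ξ i : ℂ)) = (‖ξ‖ : ℂ) ^ 2 := by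
    simp [dotProduct, ← sq, ← Complex.ofReal_pow, EuclideanSpace.real_norm_sq_eq]
  have hb : ∑ i, (-(π * Complex.I / a) • b) i * ξ i =
      -(π * Complex.I / a) * b ⬝ᵥ fun i => (ξ i : ℂ) := by
    simp [dotProduct, Finset.mul_sum, mul_assoc]
  rw [hb, sub_dotProduct, dotProduct_sub, dotProduct_sub, smul_dotProduct, smul_dotProduct,
    dotProduct_smul, dotProduct_smul, hξ, dotProduct_comm (fun i => (ξ i : ℂ)) b]
  simp only [smul_eq_mul]
  field_simp
  linear_combination (4 * π ^ 2 * ‖ξ‖ ^ 2 : ℂ) * Complex.I_sq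

lemma gaussPair_congr {f g : EuclideanSpace ℝ (Fin n) → ℂ} (h : f =ᵐ[volume] g) (a : ℂ)
    (b : Fin n → ℂ) : gaussPair f a b = gaussPair g a b :=
  integral_congr_ae (h.mono fun x hx => by simp only [hx])

lemma gaussPair_const_mul (c : ℂ) (f : EuclideanSpace ℝ (Fin n) → ℂ) (a : ℂ) (b : Fin n → ℂ) :
    gaussPair (fun x => c * f x) a b = c * gaussPair f a b := by
  simp only [gaussPair, mul_left_comm _ c, integral_const_mul]

lemma gaussPair_gauss_mul (f : EuclideanSpace ℝ (Fin n) → ℂ) (a a' : ℂ) (b b' : Fin n → ℂ) :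
    gaussPair (fun x => gauss a' b' x * f x) a b = gaussPair f (a + a') (b + b') := by
  simp only [gaussPair, gauss_add, mul_assoc]

lemma gaussPair_comp_smul (f : EuclideanSpace ℝ (Fin n) → ℂ) {ρ : ℝ} (hρ : ρ ≠ 0) (a : ℂ)
    (b : Fin n → ℂ) : gaussPair (fun x => f (ρ • x)) a b =
      (|ρ| ^ n)⁻¹ * gaussPair f (a / ρ ^ 2) ((ρ : ℂ)⁻¹ • b) := by
  have hρ' : (ρ : ℂ) ≠ 0 := Complex.ofReal_ne_zero.2 hρ
  have h (x : EuclideanSpace ℝ (Fin n)) :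
      gauss a b x = gauss (a / ρ ^ 2) ((ρ : ℂ)⁻¹ • b) (ρ • x) := by
    rw [gauss_smul, smul_inv_smul₀ hρ', mul_div_cancel₀ _ (pow_ne_zero 2 hρ')]
  simp only [gaussPair, h]
  rw [Measure.integral_comp_smul volume (fun y => gauss _ _ y * f y) ρ]
  simp [abs_inv, abs_pow]

lemma integrable_gauss_mul {a : ℂ} (ha : 0 < a.re) (b : Fin n → ℂ) (f : L2Space n) :
    Integrable (fun x => gauss a b x * f x) :=
  (memLp_gauss ha b).integrable_mul (Lp.memLp f)

end Gaussian

section FourierTransform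

variable {V : Type*} [NormedAddCommGroup V] [InnerProductSpace ℝ V] [FiniteDimensional ℝ V]
  [MeasurableSpace V] [BorelSpace V]

lemma integral_fourier_mul_eq_flip {f g : V → ℂ} (hf : Integrable f) (hg : Integrable g) :
    ∫ x, 𝓕 f x * g x = ∫ x, f x * 𝓕 g x := by
  simpa using! VectorFourier.integral_fourierIntegral_smul_eq_flip (L := innerₗ V)
    Real.continuous_fourierChar continuous_inner hf hg

lemma ae_eq_of_fourier_eq {f g : V → ℂ} (hf : Integrable f) (hg : Integrable g)
    (h : 𝓕 f = 𝓕 g) : f =ᵐ[volume] g := by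
  refine ae_eq_of_integral_contDiff_smul_eq hf.locallyIntegrable hg.locallyIntegrable
    fun ψ hψ hψc => ?_
  have hψc' : HasCompactSupport (Complex.ofRealCLM ∘ ψ) := hψc.comp_left rfl
  have hψ' : ContDiff ℝ (⊤ : ℕ∞) (Complex.ofRealCLM ∘ ψ) := by fun_prop
  let φ : 𝓢(V, ℂ) := 𝓕⁻ (hψc'.toSchwartzMap hψ')
  have hφ (x : V) : 𝓕 (φ : V → ℂ) x = ψ x := by
    rw [← SchwartzMap.fourier_coe, FourierTransform.fourier_fourierInv_eq]
    rfl
  have key {k : V → ℂ} (hk : Integrable k) : ∫ x, ψ x • k x = ∫ x, φ x * 𝓕 k x := by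
    rw [← integral_fourier_mul_eq_flip φ.integrable hk]
    simp only [hφ, Complex.real_smul]
  rw [key hf, key hg, h]

lemma continuous_integral_mul {k : V → ℂ} (hk : MemLp k 2) :
    Continuous fun f : Lp (α := V) ℂ 2 => ∫ x, k x * f x := by
  have hk' : MemLp (star k) 2 := hk.star
  have h (f : Lp (α := V) ℂ 2) : ∫ x, k x * f x = inner ℂ (hk'.toLp _) f := by
    rw [L2.inner_def]
    refine integral_congr_ae ?_
    filter_upwards [hk'.coeFn_toLp] with x hx
    simp [hx, mul_comm]
  simp only [h]
  exact continuous_const.inner continuous_id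

lemma integral_mul_fourier {k : V → ℂ} (hk₁ : Integrable k) (hk₂ : MemLp k 2)
    (hk' : MemLp (𝓕 k) 2) (f : Lp (α := V) ℂ 2) :
    ∫ x, k x * (𝓕 f : Lp (α := V) ℂ 2) x = ∫ x, 𝓕 k x * f x := by
  refine DenseRange.induction_on
    (p := fun f : Lp (α := V) ℂ 2 => ∫ x, k x * (𝓕 f : Lp (α := V) ℂ 2) x = ∫ x, 𝓕 k x * f x)
    (SchwartzMap.denseRange_toLpCLM (p := 2) ENNReal.ofNat_ne_top) f ?_ fun g => ?_
  · exact isClosed_eq ((continuous_integral_mul hk₂).comp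
      (Lp.fourierTransformₗᵢ V ℂ).continuous) (continuous_integral_mul hk')
  · have hg (k : V → ℂ) (φ : 𝓢(V, ℂ)) :
        ∫ x, k x * (φ.toLp 2 : Lp (α := V) ℂ 2) x = ∫ x, k x * φ x :=
      integral_congr_ae <| (φ.coeFn_toLp 2 volume).mono fun x hx => by simp only [hx]
    rw [SchwartzMap.toLpCLM_apply, SchwartzMap.toLp_fourier_eq, hg, hg, SchwartzMap.fourier_coe]
    exact (integral_fourier_mul_eq_flip hk₁ g.integrable).symm

end FourierTransform

section Gaussian

variable {n : ℕ}

lemma re_ofReal_div_pos {r : ℝ} (hr : 0 < r) {a : ℂ} (ha : 0 < a.re) : 0 < ((r : ℂ) / a).re := by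
  have ha0 : a ≠ 0 := by rintro rfl; simp at ha
  rw [div_eq_mul_inv, Complex.re_ofReal_mul, Complex.inv_re]
  have := Complex.normSq_pos.2 ha0
  positivity

lemma re_pi_sq_div_pos {a : ℂ} (ha : 0 < a.re) : 0 < (π ^ 2 / a : ℂ).re := by
  rw [← Complex.ofReal_pow]
  exact re_ofReal_div_pos (by positivity) ha

lemma gaussPair_fourier (f : L2Space n) {a : ℂ} (ha : 0 < a.re) (b : Fin n → ℂ) :
    gaussPair (𝓕 f : L2Space n) (π ^ 2 / a) ((π * Complex.I / a) • b) =
      (a / π) ^ ((n : ℂ) / 2) * Complex.exp (-(b ⬝ᵥ b) / (4 * a)) * gaussPair f a b := by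
  have ha0 : a ≠ 0 := by rintro rfl; simp at ha
  have hπ : (π : ℂ) ≠ 0 := Complex.ofReal_ne_zero.2 Real.pi_ne_zero
  have ha' := re_pi_sq_div_pos ha
  have hI := Complex.I_sq
  have hF : 𝓕 (gauss (π ^ 2 / a) ((π * Complex.I / a) • b)) =
      ((a / π) ^ ((n : ℂ) / 2) * Complex.exp (-(b ⬝ᵥ b) / (4 * a))) • gauss a b := by
    have h₁ : (π / (π ^ 2 / a) : ℂ) = a / π := by field_simp
    have h₂ : (π ^ 2 / (π ^ 2 / a) : ℂ) = a := by field_simp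
    have h₃ : -(π * Complex.I / (π ^ 2 / a)) * (π * Complex.I / a) = (1 : ℂ) := by
      field_simp; rw [hI]; ring
    have h₄ : (π * Complex.I / a) * ((π * Complex.I / a) * b ⬝ᵥ b) / (4 * (π ^ 2 / a)) =
        -(b ⬝ᵥ b) / (4 * a) := by field_simp; rw [hI]; ring
    rw [fourier_gauss ha', smul_smul, smul_dotProduct, dotProduct_smul, smul_eq_mul, smul_eq_mul,
      h₁, h₂, h₃, h₄, one_smul]
  rw [gaussPair, integral_mul_fourier (integrable_gauss ha' _) (memLp_gauss ha' _)
    (hF ▸ (memLp_gauss ha b).const_smul _), hF, gaussPair, ← integral_const_mul]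
  simp only [Pi.smul_apply, smul_eq_mul, mul_assoc]

lemma ae_eq_of_gaussPair_eq {f g : EuclideanSpace ℝ (Fin n) → ℂ} {a : ℂ}
    (hf : Integrable fun x => gauss a 0 x * f x) (hg : Integrable fun x => gauss a 0 x * g x)
    (h : ∀ b, gaussPair f a b = gaussPair g a b) : f =ᵐ[volume] g := by
  have key (k : EuclideanSpace ℝ (Fin n) → ℂ) (ξ : EuclideanSpace ℝ (Fin n)) :
      𝓕 (fun x => gauss a 0 x * k x) ξ =
        gaussPair k a (0 - (2 * π * Complex.I) • fun i => (ξ i : ℂ)) := by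
    simp only [Real.fourier_eq', gaussPair, ← fourierChar_smul_gauss, smul_eq_mul, ← mul_assoc]
  have hfg := ae_eq_of_fourier_eq hf hg (funext fun ξ => by rw [key, key, h])
  exact hfg.mono fun x hx => mul_left_cancel₀ (gauss_ne_zero a 0 x) hx

end Gaussian

section Flow

variable {n : ℕ}

lemma memLp_gauss_mul_of_re_eq_zero {a : ℂ} (ha : a.re = 0) (f : L2Space n) :
    MemLp (fun x => gauss a 0 x * f x) 2 := by
  refine (Lp.memLp f).of_le
    ((continuous_gauss _ _).aestronglyMeasurable.mul (Lp.aestronglyMeasurable f))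
    (.of_forall fun x => ?_)
  simp [norm_gauss, ha]

/-- Multiplication of an `L²` function by the unimodular chirp `exp (i σ |x|²)`. -/
noncomputable def chirp (σ : ℝ) (f : L2Space n) : L2Space n :=
  (memLp_gauss_mul_of_re_eq_zero (a := -(σ * Complex.I)) (by simp) f).toLp

lemma coeFn_chirp (σ : ℝ) (f : L2Space n) :
    chirp σ f =ᵐ[volume] fun x => gauss (-(σ * Complex.I)) 0 x * f x :=
  MemLp.coeFn_toLp _

lemma norm_coeFn_chirp (σ : ℝ) (f : L2Space n) : ∀ᵐ x, ‖chirp σ f x‖ = ‖f x‖ :=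
  (coeFn_chirp σ f).mono fun x hx => by simp [hx, norm_gauss]

lemma chirp_zero (f : L2Space n) : chirp 0 f = f := by
  refine Lp.ext ((coeFn_chirp 0 f).trans (.of_forall fun x => ?_))
  simp [gauss]

lemma chirp_chirp (σ τ : ℝ) (f : L2Space n) : chirp σ (chirp τ f) = chirp (σ + τ) f := by
  refine Lp.ext ?_
  filter_upwards [coeFn_chirp σ (chirp τ f), coeFn_chirp τ f, coeFn_chirp (σ + τ) f] with x h₁ h₂ h₃
  rw [h₁, h₂, h₃, ← mul_assoc, ← gauss_add, add_zero, Complex.ofReal_add, add_mul, neg_add]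

lemma gaussPair_chirp (σ : ℝ) (f : L2Space n) (a : ℂ) (b : Fin n → ℂ) :
    gaussPair (chirp σ f) a b = gaussPair f (a - σ * Complex.I) b := by
  rw [gaussPair_congr (coeFn_chirp σ f), gaussPair_gauss_mul, add_zero, sub_eq_add_neg]

/-- The free Schrödinger group `exp (i s Δ)`, as the Fourier multiplier `exp (-4 π² i s |ξ|²)`. -/
noncomputable def freeFlow (s : ℝ) (f : L2Space n) : L2Space n :=
  𝓕⁻ (chirp (-(4 * π ^ 2 * s)) (𝓕 f))

lemma fourier_freeFlow (s : ℝ) (f : L2Space n) :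
    𝓕 (freeFlow s f) = chirp (-(4 * π ^ 2 * s)) (𝓕 f) :=
  FourierTransform.fourier_fourierInv_eq _

lemma freeFlow_freeFlow (s t : ℝ) (f : L2Space n) :
    freeFlow s (freeFlow t f) = freeFlow (s + t) f := by
  rw [freeFlow, fourier_freeFlow, chirp_chirp, freeFlow]
  ring_nf

lemma one_add_ne_zero_and_re_div_pos {a : ℂ} (ha : 0 < a.re) (s : ℝ) :
    1 + 4 * Complex.I * a * s ≠ 0 ∧ 0 < (a / (1 + 4 * Complex.I * a * s)).re := by
  have ha0 : a ≠ 0 := by rintro rfl; simp at ha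
  have hpos : 0 < ((1 + 4 * Complex.I * a * s) / a).re := by
    have h : (1 + 4 * Complex.I * a * s) / a = ((1 : ℝ) : ℂ) / a + 4 * Complex.I * s := by
      push_cast; field_simp
    rw [h]
    simpa using re_ofReal_div_pos one_pos ha
  refine ⟨fun h => by simp [h] at hpos, ?_⟩
  simpa using re_ofReal_div_pos one_pos hpos

lemma norm_cpow_natCast_div_two (z : ℂ) (n : ℕ) : ‖z ^ ((n : ℂ) / 2)‖ = ‖z‖ ^ (n / 2 : ℝ) := by
  rw [← Complex.norm_cpow_real]
  push_cast
  rfl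

lemma gaussPair_freeFlow {a : ℂ} (ha : 0 < a.re) (s : ℝ) {E : ℂ}
    (hE : E = 1 + 4 * Complex.I * a * s) :
    ∃ C : ℂ, ‖C‖ = ‖E‖ ^ (-(n / 2) : ℝ) ∧ ∀ (f : L2Space n) (b : Fin n → ℂ),
      gaussPair (freeFlow s f) a b =
        C * Complex.exp (Complex.I * s * b ⬝ᵥ b / E) * gaussPair f (a / E) (E⁻¹ • b) := by
  have ha0 : a ≠ 0 := by rintro rfl; simp at ha
  have hπ : (π : ℂ) ≠ 0 := Complex.ofReal_ne_zero.2 Real.pi_ne_zero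
  obtain ⟨hE0, hre⟩ := hE ▸ one_add_ne_zero_and_re_div_pos ha s
  have hC : (a / π) ^ ((n : ℂ) / 2) ≠ 0 := by
    rw [Complex.cpow_ne_zero_iff]
    exact .inl (div_ne_zero ha0 hπ)
  refine ⟨(a / E / π) ^ ((n : ℂ) / 2) / (a / π) ^ ((n : ℂ) / 2), ?_, fun f b => ?_⟩
  · rw [norm_div, norm_cpow_natCast_div_two, norm_cpow_natCast_div_two,
      ← Real.div_rpow (norm_nonneg _) (norm_nonneg _), ← norm_div, Real.rpow_neg (norm_nonneg _),
      ← Real.inv_rpow (norm_nonneg _), ← norm_inv]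
    congr 2
    field_simp
  · have hwidth : (π ^ 2 / a - (-(4 * π ^ 2 * s) : ℝ) * Complex.I : ℂ) = π ^ 2 / (a / E) := by
      push_cast; rw [hE]; field_simp; ring
    have hdrift : (π * Complex.I / a) • b = (π * Complex.I / (a / E)) • E⁻¹ • b := by
      rw [smul_smul]; congr 1; field_simp
    have hexp : Complex.exp (-((E⁻¹ • b) ⬝ᵥ (E⁻¹ • b)) / (4 * (a / E))) =
        Complex.exp (-(b ⬝ᵥ b) / (4 * a)) * Complex.exp (Complex.I * s * b ⬝ᵥ b / E) := by
      rw [← Complex.exp_add, smul_dotProduct, dotProduct_smul, smul_eq_mul, smul_eq_mul]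
      congr 1
      field_simp
      rw [hE]
      ring
    have key := gaussPair_fourier (freeFlow s f) ha b
    rw [fourier_freeFlow, gaussPair_chirp, hwidth, hdrift, gaussPair_fourier f hre, hexp] at key
    refine mul_left_cancel₀ (mul_ne_zero hC (Complex.exp_ne_zero (-(b ⬝ᵥ b) / (4 * a)))) ?_
    rw [← key]
    field_simp

lemma exists_gaussPair_freeFlow_eq_chirp {s : ℝ} (hs : s ≠ 0) :
    ∃ C : ℂ, ‖C‖ = |4 * s| ^ (n / 2 : ℝ) ∧ ∀ (f : L2Space n) (b : Fin n → ℂ),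
      gaussPair (freeFlow s f) ((1 + 4 * s * Complex.I) / (16 * s ^ 2))
          ((Complex.I / (4 * s)) • b) =
        C * Complex.exp (-(b ⬝ᵥ b) / (4 * 1)) * gaussPair (chirp (4 * s)⁻¹ f) 1 b := by
  have hsC : (s : ℂ) ≠ 0 := Complex.ofReal_ne_zero.2 hs
  have hI := Complex.I_sq
  set a : ℂ := (1 + 4 * s * Complex.I) / (16 * s ^ 2) with ha_def
  have ha : 0 < a.re := by
    have h : a = (1 / (16 * s ^ 2) : ℝ) + (1 / (4 * s) : ℝ) * Complex.I := by
      rw [ha_def]; push_cast; field_simp; ring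
    have : 0 < 1 / (16 * s ^ 2) := by positivity
    rwa [h, Complex.add_re, Complex.re_ofReal_mul, Complex.I_re, mul_zero, add_zero]
  have hE : Complex.I / (4 * s) = 1 + 4 * Complex.I * a * s := by
    rw [ha_def]; field_simp; linear_combination (-64 * s : ℂ) * hI
  obtain ⟨C, hC, hflow⟩ := gaussPair_freeFlow (n := n) ha s hE
  refine ⟨C, ?_, fun f b => ?_⟩
  · have hnorm : ‖Complex.I / (4 * s)‖ = |4 * s|⁻¹ := by simp [abs_mul]
    rw [hC, hnorm, Real.rpow_neg (by positivity), Real.inv_rpow (abs_nonneg _), inv_inv]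
  · have hdiv : a / (Complex.I / (4 * s)) = 1 - ((4 * s)⁻¹ : ℝ) * Complex.I := by
      rw [ha_def]; push_cast; field_simp; linear_combination 16 * hI
    have hexp : Complex.I * s * (Complex.I / (4 * s) * (Complex.I / (4 * s) * b ⬝ᵥ b)) /
        (Complex.I / (4 * s)) = -(b ⬝ᵥ b) / (4 * 1) := by
      field_simp; rw [hI]; ring
    rw [hflow, gaussPair_chirp, hdiv, inv_smul_smul₀ (div_ne_zero Complex.I_ne_zero (by simpa)),
      smul_dotProduct, dotProduct_smul, smul_eq_mul, smul_eq_mul, hexp]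

lemma exists_gaussPair_freeFlow_comp_smul {s : ℝ} (hs : s ≠ 0) :
    ∃ C : ℂ, ‖C‖ = |4 * π * s| ^ (-(n / 2) : ℝ) ∧ ∀ (f : L2Space n) (b : Fin n → ℂ),
      gaussPair (fun η => gauss (4 * π ^ 2 * s * Complex.I) 0 η * freeFlow s f ((4 * π * s) • η))
        (π ^ 2) b = C * gaussPair (𝓕 (chirp (4 * s)⁻¹ f) : L2Space n) (π ^ 2) b := by
  have hsC : (s : ℂ) ≠ 0 := Complex.ofReal_ne_zero.2 hs
  have hπ : (π : ℂ) ≠ 0 := Complex.ofReal_ne_zero.2 Real.pi_ne_zero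
  obtain ⟨C, hC, hflow⟩ := exists_gaussPair_freeFlow_eq_chirp (n := n) hs
  set K : ℂ := (1 / π : ℂ) ^ ((n : ℂ) / 2) with hK_def
  have hK : ‖K‖ = (π ^ (n / 2 : ℝ))⁻¹ := by
    rw [norm_cpow_natCast_div_two, one_div, norm_inv, Complex.norm_of_nonneg Real.pi_nonneg,
      Real.inv_rpow Real.pi_nonneg]
  have hK0 : K ≠ 0 := by rw [← norm_ne_zero_iff, hK]; positivity
  refine ⟨(|4 * π * s| ^ n)⁻¹ * C / K, ?_, fun f b => ?_⟩
  · have hρ : |4 * π * s| = |4 * s| * π := by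
      rw [mul_right_comm, abs_mul, abs_of_pos Real.pi_pos]
    have hsq : |4 * π * s| ^ n = |4 * π * s| ^ (n / 2 : ℝ) * |4 * π * s| ^ (n / 2 : ℝ) := by
      rw [← Real.rpow_add (by positivity), add_halves, Real.rpow_natCast]
    rw [norm_div, norm_mul, hC, hK, Complex.norm_real, norm_inv, norm_pow, norm_abs_eq_norm,
      Real.norm_eq_abs, hsq, hρ, Real.rpow_neg (by positivity),
      Real.mul_rpow (abs_nonneg _) Real.pi_nonneg]
    field_simp
  · obtain ⟨d, rfl⟩ : ∃ d, b = (π * Complex.I / 1) • d :=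
      ⟨(π * Complex.I / 1 : ℂ)⁻¹ • b, (smul_inv_smul₀ (by simp [Real.pi_ne_zero]) b).symm⟩
    have hF := gaussPair_fourier (chirp (4 * s)⁻¹ f) (a := 1) (by simp) d
    have hwidth : (π ^ 2 + 4 * π ^ 2 * s * Complex.I) / ((4 * π * s : ℝ) : ℂ) ^ 2 =
        (1 + 4 * s * Complex.I) / (16 * s ^ 2) := by push_cast; field_simp; ring
    have hdrift : ((4 * π * s : ℝ) : ℂ)⁻¹ * (π * Complex.I / 1) = Complex.I / (4 * s) := by
      push_cast; field_simp
    rw [div_one] at hF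
    rw [gaussPair_gauss_mul, add_zero, gaussPair_comp_smul _ (by positivity), hwidth, smul_smul,
      hdrift, hflow, hF, ← hK_def]
    field_simp

lemma norm_freeFlow_smul {s : ℝ} (hs : s ≠ 0) (f : L2Space n) :
    ∀ᵐ η, ‖freeFlow s f ((4 * π * s) • η)‖ =
      |4 * π * s| ^ (-(n / 2) : ℝ) * ‖(𝓕 (chirp (4 * s)⁻¹ f) : L2Space n) η‖ := by
  have hρ : 4 * π * s ≠ 0 := by positivity
  have hρC : ((4 * π * s : ℝ) : ℂ) ≠ 0 := Complex.ofReal_ne_zero.2 hρ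
  have hπ : 0 < (π ^ 2 : ℂ).re := by rw [← Complex.ofReal_pow, Complex.ofReal_re]; positivity
  obtain ⟨C, hC, hpair⟩ := exists_gaussPair_freeFlow_comp_smul (n := n) hs
  have hint : Integrable fun η => gauss (π ^ 2) 0 η *
      (gauss (4 * π ^ 2 * s * Complex.I) 0 η * freeFlow s f ((4 * π * s) • η)) := by
    have hre : 0 < ((π ^ 2 + 4 * π ^ 2 * s * Complex.I) / ((4 * π * s : ℝ) : ℂ) ^ 2).re := by
      rw [← Complex.ofReal_pow (4 * π * s), Complex.div_ofReal_re]
      have : (π ^ 2 + 4 * π ^ 2 * s * Complex.I : ℂ).re = π ^ 2 := by simp [← Complex.ofReal_pow]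
      rw [this]
      positivity
    refine ((integrable_gauss_mul hre 0 (freeFlow s f)).comp_smul hρ).congr (.of_forall fun η => ?_)
    simp only
    rw [gauss_smul, mul_div_cancel₀ _ (pow_ne_zero 2 hρC), smul_zero, ← mul_assoc, ← gauss_add,
      add_zero]
  have h := ae_eq_of_gaussPair_eq hint
    (((integrable_gauss_mul hπ 0 (𝓕 (chirp (4 * s)⁻¹ f))).const_mul C).congr
      (.of_forall fun η => mul_left_comm _ _ _))
    fun b => (hpair f b).trans (gaussPair_const_mul _ _ _ _).symm
  have hre : (4 * π ^ 2 * s * Complex.I : ℂ).re = 0 := by simp [← Complex.ofReal_pow]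
  filter_upwards [h] with η hη
  simpa [norm_gauss, hre, hC] using congrArg norm hη

end Flow

section ComplexTranslation

variable {n : ℕ}

/-- `g` is the translate `x ↦ f (x + z)` by the complex vector `z`, in the weak sense obtained from
shifting the contour in the pairings with all Gaussians: `f` itself need not extend to `ℂⁿ`. -/
structure IsComplexTranslate (z : Fin n → ℂ) (f g : EuclideanSpace ℝ (Fin n) → ℂ) : Prop where
  integrable : ∀ a : ℂ, 0 < a.re → ∀ b : Fin n → ℂ, Integrable fun x => gauss a b x * g x
  gaussPair_eq : ∀ a : ℂ, 0 < a.re → ∀ b : Fin n → ℂ,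
    gaussPair g a b = Complex.exp (-a * z ⬝ᵥ z - b ⬝ᵥ z) * gaussPair f a (b + (2 * a) • z)

lemma IsComplexTranslate.ae_eq {z : Fin n → ℂ} {f g g' : EuclideanSpace ℝ (Fin n) → ℂ}
    (hg : IsComplexTranslate z f g) (hg' : IsComplexTranslate z f g') : g =ᵐ[volume] g' :=
  have h1 : 0 < (1 : ℂ).re := by simp
  ae_eq_of_gaussPair_eq (hg.integrable 1 h1 0) (hg'.integrable 1 h1 0) fun b => by
    rw [hg.gaussPair_eq 1 h1, hg'.gaussPair_eq 1 h1]

lemma IsComplexTranslate.aestronglyMeasurable {z : Fin n → ℂ}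
    {f g : EuclideanSpace ℝ (Fin n) → ℂ} (hg : IsComplexTranslate z f g) :
    AEStronglyMeasurable g volume := by
  have hinv : Continuous fun x : EuclideanSpace ℝ (Fin n) => (gauss 1 0 x)⁻¹ :=
    (continuous_gauss 1 0).inv₀ (gauss_ne_zero 1 0)
  refine (hinv.aestronglyMeasurable.mul
    (hg.integrable 1 (by simp) 0).aestronglyMeasurable).congr (.of_forall fun x => ?_)
  exact inv_mul_cancel_left₀ (gauss_ne_zero 1 0 x) (g x)

lemma IsComplexTranslate.congr {z : Fin n → ℂ} {f g g' : EuclideanSpace ℝ (Fin n) → ℂ}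
    (hg : IsComplexTranslate z f g) (h : g =ᵐ[volume] g') : IsComplexTranslate z f g' where
  integrable a ha b := (hg.integrable a ha b).congr (h.mono fun x hx => by simp only [hx])
  gaussPair_eq a ha b := by rw [← gaussPair_congr h, hg.gaussPair_eq a ha b]

lemma IsComplexTranslate.chirp {z : Fin n → ℂ} {f : L2Space n} {g : EuclideanSpace ℝ (Fin n) → ℂ}
    (hg : IsComplexTranslate z f g) (σ : ℝ) :
    IsComplexTranslate z (chirp σ f) fun x => Complex.exp (σ * Complex.I * z ⬝ᵥ z) *
      (gauss (-(σ * Complex.I)) ((2 * σ * Complex.I) • z) x * g x) where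
  integrable a ha b := by
    have ha' : 0 < (a + -(σ * Complex.I)).re := by simpa using ha
    refine ((hg.integrable _ ha' (b + (2 * σ * Complex.I) • z)).const_mul
      (Complex.exp (σ * Complex.I * z ⬝ᵥ z))).congr (.of_forall fun x => ?_)
    simp only [gauss_add]
    ring
  gaussPair_eq a ha b := by
    have ha' : 0 < (a + -(σ * Complex.I)).re := by simpa using ha
    have hdrift : b + (2 * σ * Complex.I) • z + (2 * (a + -(σ * Complex.I))) • z =
        b + (2 * a) • z := by
      rw [add_assoc, ← add_smul]; ring_nf
    rw [gaussPair_const_mul, gaussPair_gauss_mul, hg.gaussPair_eq _ ha', hdrift, gaussPair_chirp,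
      ← mul_assoc, ← Complex.exp_add, add_dotProduct, smul_dotProduct, smul_eq_mul,
      ← sub_eq_add_neg]
    congr 2
    ring

lemma gaussPair_translate_iff (z : Fin n → ℂ) (f g : L2Space n) {a : ℂ} (ha : 0 < a.re)
    (b : Fin n → ℂ) :
    gaussPair g a b = Complex.exp (-a * z ⬝ᵥ z - b ⬝ᵥ z) * gaussPair f a (b + (2 * a) • z) ↔
      gaussPair (𝓕 g : L2Space n) (π ^ 2 / a) ((π * Complex.I / a) • b) =
        gaussPair (fun ξ => gauss 0 ((2 * π * Complex.I) • z) ξ * (𝓕 f : L2Space n) ξ)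
          (π ^ 2 / a) ((π * Complex.I / a) • b) := by
  have ha0 : a ≠ 0 := by rintro rfl; simp at ha
  have hπ : (π : ℂ) ≠ 0 := Complex.ofReal_ne_zero.2 Real.pi_ne_zero
  have hC : (a / π) ^ ((n : ℂ) / 2) * Complex.exp (-(b ⬝ᵥ b) / (4 * a)) ≠ 0 := by
    refine mul_ne_zero ?_ (Complex.exp_ne_zero _)
    rw [Complex.cpow_ne_zero_iff]
    exact .inl (div_ne_zero ha0 hπ)
  have hdrift : (π * Complex.I / a) • b + (2 * π * Complex.I) • z =
      (π * Complex.I / a) • (b + (2 * a) • z) := by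
    rw [smul_add, smul_smul]
    congr 2
    field_simp
  have hexp : Complex.exp (-((b + (2 * a) • z) ⬝ᵥ (b + (2 * a) • z)) / (4 * a)) =
      Complex.exp (-(b ⬝ᵥ b) / (4 * a)) * Complex.exp (-a * z ⬝ᵥ z - b ⬝ᵥ z) := by
    rw [← Complex.exp_add]
    simp only [add_dotProduct, dotProduct_add, smul_dotProduct, dotProduct_smul, smul_eq_mul,
      dotProduct_comm z b]
    congr 1
    field_simp
    ring
  rw [gaussPair_gauss_mul, add_zero, hdrift, gaussPair_fourier g ha, gaussPair_fourier f ha, hexp,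
    ← mul_assoc (_ ^ _) (Complex.exp _), mul_assoc (_ * _) (Complex.exp _), mul_right_inj' hC]

lemma isComplexTranslate_iff_fourier (z : Fin n → ℂ) (f g : L2Space n) :
    IsComplexTranslate z f g ↔ (𝓕 g : L2Space n) =ᵐ[volume]
      fun ξ => gauss 0 ((2 * π * Complex.I) • z) ξ * (𝓕 f : L2Space n) ξ := by
  refine ⟨fun h => ?_, fun h => ⟨fun a ha b => integrable_gauss_mul ha b g, fun a ha b =>
    (gaussPair_translate_iff z f g ha b).2 (gaussPair_congr h _ _)⟩⟩
  have h1 : 0 < (1 : ℂ).re := by simp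
  have hint := integrable_gauss_mul (re_pi_sq_div_pos h1) ((2 * π * Complex.I) • z) (𝓕 f)
  refine ae_eq_of_gaussPair_eq (a := π ^ 2 / 1) (integrable_gauss_mul (re_pi_sq_div_pos h1) 0 _)
    (hint.congr (.of_forall fun ξ => ?_)) fun b => ?_
  · simp only [← mul_assoc, ← gauss_add, add_zero, zero_add]
  · obtain ⟨d, rfl⟩ : ∃ d, b = (π * Complex.I / 1) • d :=
      ⟨(π * Complex.I / 1 : ℂ)⁻¹ • b, (smul_inv_smul₀ (by simp [Real.pi_ne_zero]) b).symm⟩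
    exact (gaussPair_translate_iff z f g h1 d).1 (h.gaussPair_eq 1 h1 d)

end ComplexTranslation

section LinearWeights

variable {n : ℕ}

/-- The norm `‖exp (l · x) f‖₂` in `[0, ∞]`. -/
noncomputable def expNorm (l : Fin n → ℝ) (f : EuclideanSpace ℝ (Fin n) → ℂ) : ℝ≥0∞ :=
  eLpNorm (fun x => gauss 0 (fun i => (l i : ℂ)) x * f x) 2 volume

lemma eLpNorm_fourier (f : L2Space n) :
    eLpNorm (𝓕 f : L2Space n) 2 volume = eLpNorm f 2 volume := by
  rw [← Lp.enorm_def, ← Lp.enorm_def, enorm_eq_iff_norm_eq, Lp.norm_fourier_eq]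

lemma two_pi_I_smul_linear (l : Fin n → ℝ) :
    (2 * π * Complex.I) • (2 * π * Complex.I)⁻¹ • (fun i => (l i : ℂ)) = fun i => (l i : ℂ) :=
  smul_inv_smul₀ (by simp [Real.pi_ne_zero]) _

lemma exists_isComplexTranslate {l : Fin n → ℝ} {f : L2Space n}
    (hf : expNorm l (𝓕 f : L2Space n) ≠ ∞) :
    ∃ g : L2Space n, IsComplexTranslate ((2 * π * Complex.I)⁻¹ • fun i => (l i : ℂ)) f g ∧
      eLpNorm g 2 volume = expNorm l (𝓕 f : L2Space n) := by
  have hmem : MemLp (fun ξ => gauss 0 (fun i => (l i : ℂ)) ξ * (𝓕 f : L2Space n) ξ) 2 :=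
    ⟨(continuous_gauss _ _).aestronglyMeasurable.mul (Lp.aestronglyMeasurable _), hf.lt_top⟩
  have hF : (𝓕 (𝓕⁻ hmem.toLp : L2Space n) : L2Space n) = hmem.toLp :=
    FourierTransform.fourier_fourierInv_eq _
  refine ⟨𝓕⁻ hmem.toLp, ?_, ?_⟩
  · rw [isComplexTranslate_iff_fourier, hF, two_pi_I_smul_linear]
    exact hmem.coeFn_toLp
  · rw [← eLpNorm_fourier, hF, expNorm]
    exact eLpNorm_congr_ae hmem.coeFn_toLp

lemma IsComplexTranslate.eLpNorm_eq_expNorm_fourier {l : Fin n → ℝ} {f : L2Space n}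
    {g : EuclideanSpace ℝ (Fin n) → ℂ}
    (hg : IsComplexTranslate ((2 * π * Complex.I)⁻¹ • fun i => (l i : ℂ)) f g) :
    eLpNorm g 2 volume = expNorm l (𝓕 f : L2Space n) := by
  by_cases hf : expNorm l (𝓕 f : L2Space n) = ∞
  · rw [hf]
    by_contra hg_top
    have hmem : MemLp g 2 := ⟨hg.aestronglyMeasurable, Ne.lt_top hg_top⟩
    have hgLp : IsComplexTranslate ((2 * π * Complex.I)⁻¹ • fun i => (l i : ℂ)) f hmem.toLp :=
      hg.congr hmem.coeFn_toLp.symm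
    rw [isComplexTranslate_iff_fourier, two_pi_I_smul_linear] at hgLp
    rw [expNorm, ← eLpNorm_congr_ae hgLp] at hf
    exact (Lp.memLp (𝓕 hmem.toLp : L2Space n)).eLpNorm_ne_top hf
  · obtain ⟨g', hg', hnorm⟩ := exists_isComplexTranslate hf
    rw [← hnorm, eLpNorm_congr_ae (hg.ae_eq hg')]

lemma IsComplexTranslate.expNorm_fourier_chirp {l : Fin n → ℝ} {f : L2Space n}
    {g : EuclideanSpace ℝ (Fin n) → ℂ}
    (hg : IsComplexTranslate ((2 * π * Complex.I)⁻¹ • fun i => (l i : ℂ)) f g) (σ : ℝ) :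
    expNorm l (𝓕 (_root_.chirp σ f) : L2Space n) = expNorm ((σ / π) • l) g := by
  rw [← (hg.chirp σ).eLpNorm_eq_expNorm_fourier, expNorm]
  have hπ : (π : ℂ) ≠ 0 := Complex.ofReal_ne_zero.2 Real.pi_ne_zero
  have hdrift : (2 * σ * Complex.I) • (2 * π * Complex.I)⁻¹ • (fun i => (l i : ℂ)) =
      fun i => (((σ / π) • l) i : ℂ) := by
    ext i
    simp only [Pi.smul_apply, smul_eq_mul, Complex.ofReal_mul, Complex.ofReal_div]
    field_simp
  have hphase : (σ * Complex.I * ((2 * π * Complex.I)⁻¹ • fun i => (l i : ℂ)) ⬝ᵥ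
      ((2 * π * Complex.I)⁻¹ • fun i => (l i : ℂ))) =
      (-(σ * l ⬝ᵥ l / (4 * π ^ 2)) : ℝ) * Complex.I := by
    have hl : (fun i => (l i : ℂ)) ⬝ᵥ (fun i => (l i : ℂ)) = (l ⬝ᵥ l : ℝ) := by simp [dotProduct]
    rw [smul_dotProduct, dotProduct_smul, hl]
    simp only [smul_eq_mul]
    push_cast
    field_simp
    rw [Complex.I_sq]
    ring
  refine eLpNorm_congr_norm_ae (.of_forall fun x => ?_)
  rw [hdrift, hphase, norm_mul, norm_mul, norm_mul, Complex.norm_exp_ofReal_mul_I, norm_gauss,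
    norm_gauss]
  simp

lemma eLpNorm_le_rpow_mul_rpow {α E F G : Type*} [MeasurableSpace α] [NormedAddCommGroup E]
    [NormedAddCommGroup F] [NormedAddCommGroup G] {μ : Measure α} {p : ℝ≥0∞} (hp₀ : p ≠ 0)
    (hp : p ≠ ∞) {f : α → E} {f₀ : α → F} {f₁ : α → G} (h₀ : AEStronglyMeasurable f₀ μ)
    (h₁ : AEStronglyMeasurable f₁ μ) {θ : ℝ} (hθ₀ : 0 ≤ θ) (hθ₁ : θ ≤ 1)
    (h : ∀ᵐ x ∂μ, ‖f x‖ₑ ≤ ‖f₀ x‖ₑ ^ θ * ‖f₁ x‖ₑ ^ (1 - θ)) :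
    eLpNorm f p μ ≤ eLpNorm f₀ p μ ^ θ * eLpNorm f₁ p μ ^ (1 - θ) := by
  have hθ' : 0 ≤ 1 - θ := sub_nonneg.2 hθ₁
  have hp' : 0 ≤ p.toReal := ENNReal.toReal_nonneg
  have hp'' : 0 ≤ 1 / p.toReal := by positivity
  have hcomm (x : ℝ≥0∞) (r s : ℝ) : (x ^ r) ^ s = (x ^ s) ^ r := by
    rw [← ENNReal.rpow_mul, mul_comm, ENNReal.rpow_mul]
  simp only [eLpNorm_eq_lintegral_rpow_enorm_toReal hp₀ hp]
  rw [hcomm _ _ θ, hcomm _ _ (1 - θ), ← ENNReal.mul_rpow_of_nonneg _ _ hp'']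
  refine ENNReal.rpow_le_rpow (le_trans (lintegral_mono_ae ?_) (ENNReal.lintegral_mul_norm_pow_le
    (h₀.enorm.pow_const _) (h₁.enorm.pow_const _) hθ₀ hθ' (add_sub_cancel θ 1))) hp''
  filter_upwards [h] with x hx
  rw [hcomm _ _ θ, hcomm _ _ (1 - θ), ← ENNReal.mul_rpow_of_nonneg _ _ hp']
  exact ENNReal.rpow_le_rpow hx hp'

lemma expNorm_le_rpow_mul_rpow {f : EuclideanSpace ℝ (Fin n) → ℂ}
    (hf : AEStronglyMeasurable f volume) (l₀ l₁ : Fin n → ℝ) {θ : ℝ} (hθ₀ : 0 ≤ θ) (hθ₁ : θ ≤ 1) :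
    expNorm (θ • l₀ + (1 - θ) • l₁) f ≤ expNorm l₀ f ^ θ * expNorm l₁ f ^ (1 - θ) := by
  refine eLpNorm_le_rpow_mul_rpow two_ne_zero ENNReal.ofNat_ne_top
    ((continuous_gauss _ _).aestronglyMeasurable.mul hf)
    ((continuous_gauss _ _).aestronglyMeasurable.mul hf) hθ₀ hθ₁ (.of_forall fun x => le_of_eq ?_)
  have hθ' : 0 ≤ 1 - θ := sub_nonneg.2 hθ₁
  have hexp : ‖gauss 0 (fun i => ((θ • l₀ + (1 - θ) • l₁) i : ℂ)) x‖ₑ =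
      ‖gauss 0 (fun i => (l₀ i : ℂ)) x‖ₑ ^ θ * ‖gauss 0 (fun i => (l₁ i : ℂ)) x‖ₑ ^ (1 - θ) := by
    simp only [← ofReal_norm, norm_gauss]
    rw [ENNReal.ofReal_rpow_of_pos (Real.exp_pos _), ENNReal.ofReal_rpow_of_pos (Real.exp_pos _),
      ← ENNReal.ofReal_mul (by positivity), ← Real.exp_mul, ← Real.exp_mul, ← Real.exp_add]
    simp [add_mul, Finset.sum_add_distrib, Finset.sum_mul, mul_right_comm _ (x _), mul_comm θ,
      mul_comm (1 - θ)]
  simp only [Pi.mul_apply]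
  rw [enorm_mul, enorm_mul, enorm_mul, hexp, ENNReal.mul_rpow_of_nonneg _ _ hθ₀,
    ENNReal.mul_rpow_of_nonneg _ _ hθ', mul_mul_mul_comm, ← ENNReal.rpow_add_of_nonneg _ _ hθ₀ hθ',
    add_sub_cancel, ENNReal.rpow_one]

lemma expNorm_fourier_chirp_le (v : L2Space n) (l : Fin n → ℝ) (σ₀ σ₁ : ℝ) {θ : ℝ} (hθ₀ : 0 ≤ θ)
    (hθ₁ : θ ≤ 1) : expNorm l (𝓕 (chirp (θ * σ₀ + (1 - θ) * σ₁) v) : L2Space n) ≤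
      expNorm l (𝓕 (chirp σ₀ v) : L2Space n) ^ θ *
        expNorm l (𝓕 (chirp σ₁ v) : L2Space n) ^ (1 - θ) := by
  by_cases hfin : ∃ σ, expNorm l (𝓕 (chirp σ v) : L2Space n) ≠ ∞
  · obtain ⟨σ, hσ⟩ := hfin
    obtain ⟨g, hg, -⟩ := exists_isComplexTranslate hσ
    have hv := hg.chirp (-σ)
    rw [chirp_chirp, neg_add_cancel, chirp_zero] at hv
    have hl : ((θ * σ₀ + (1 - θ) * σ₁) / π) • l =
        θ • ((σ₀ / π) • l) + (1 - θ) • ((σ₁ / π) • l) := by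
      rw [smul_smul, smul_smul, ← add_smul]
      ring_nf
    rw [hv.expNorm_fourier_chirp, hv.expNorm_fourier_chirp, hv.expNorm_fourier_chirp, hl]
    exact expNorm_le_rpow_mul_rpow hv.aestronglyMeasurable _ _ hθ₀ hθ₁
  · push Not at hfin
    rw [hfin, hfin, hfin, ← ENNReal.rpow_add_of_nonneg _ _ hθ₀ (sub_nonneg.2 hθ₁), add_sub_cancel,
      ENNReal.rpow_one]

end LinearWeights

section Subordination

lemma rpow_mul_rpow_le {r s σ : ℝ} (hr₁ : 1 ≤ r) (hr₂ : r ≤ 2) (hs : 0 ≤ s) (hσ : 0 ≤ σ) :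
    s ^ (2 - r) * σ ^ r ≤ σ * ((2 - r) * s + (r - 1) * σ) := by
  have hσr : σ ^ r = σ ^ (r - 1) * σ := by
    rw [← Real.rpow_add_one' hσ (by linarith), sub_add_cancel]
  have hmean := Real.geom_mean_le_arith_mean2_weighted (sub_nonneg.2 hr₂) (sub_nonneg.2 hr₁) hs hσ
    (by ring)
  rw [hσr, ← mul_assoc, mul_comm _ σ]
  gcongr

lemma le_rpow_mul_rpow {r s σ : ℝ} (hr₁ : 1 ≤ r) (hs : 0 ≤ s) (hσ : 0 ≤ σ) :
    s * ((1 - r) * s + r * σ) ≤ s ^ (2 - r) * σ ^ r := by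
  rcases hs.eq_or_lt with rfl | hs
  · simp only [zero_mul]; positivity
  have hbernoulli := one_add_mul_self_le_rpow_one_add
    (by linarith [div_nonneg hσ hs.le] : -1 ≤ σ / s - 1) hr₁
  rw [add_sub_cancel, Real.div_rpow hσ hs.le] at hbernoulli
  calc s * ((1 - r) * s + r * σ) = s ^ 2 * (1 + r * (σ / s - 1)) := by field_simp; ring
    _ ≤ s ^ 2 * (σ ^ r / s ^ r) := by gcongr
    _ = s ^ (2 - r) * σ ^ r := by rw [Real.rpow_sub hs, Real.rpow_two]; ring

/-- The slope of `y ↦ |y| ^ p` at the point `y` with `s = sign y * |y| ^ (p / 2)`. In the parameter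
`s` the gap between `|y| ^ p` and its tangents is comparable to a square, see
`tangentSlope_mul_sub_le` and `le_tangentSlope_mul_sub`. -/
noncomputable def tangentSlope (p s : ℝ) : ℝ := p * s * |s| ^ (1 - 2 / p)

variable {p : ℝ}

lemma measurable_tangentSlope (p : ℝ) : Measurable (tangentSlope p) := by
  unfold tangentSlope; fun_prop

lemma abs_tangentSlope (hp : 1 < p) (s : ℝ) : |tangentSlope p s| = p * |s| ^ (2 - 2 / p) := by
  have h : (2 - 2 / p) = 1 - 2 / p + 1 := by ring
  have h0 : 1 - 2 / p + 1 ≠ 0 := by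
    have : 2 / p < 2 := div_lt_self two_pos hp
    linarith
  rw [tangentSlope, abs_mul, abs_mul, abs_of_pos (by linarith : 0 < p),
    abs_of_nonneg (by positivity : 0 ≤ |s| ^ (1 - 2 / p)), h, Real.rpow_add_one' (abs_nonneg s) h0]
  ring

lemma abs_rpow_half_rpow (hp : 1 < p) (y : ℝ) : (|y| ^ (p / 2)) ^ (2 / p) = |y| := by
  rw [← Real.rpow_mul (abs_nonneg y), div_mul_div_cancel₀ two_ne_zero, div_self (by linarith),
    Real.rpow_one]

lemma sq_abs_rpow_half (p y : ℝ) : (|y| ^ (p / 2)) ^ 2 = |y| ^ p := by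
  rw [← Real.rpow_mul_natCast (abs_nonneg y)]
  norm_num

lemma tangentSlope_mul_sub_le (hp : 1 < p) (hp₂ : p ≤ 2) (s y : ℝ) :
    tangentSlope p s * y - (p - 1) * s ^ 2 ≤
      |y| ^ p - (p - 1) * (|s| - |y| ^ (p / 2)) ^ 2 := by
  have hmean := rpow_mul_rpow_le (r := 2 / p) ((one_le_div (by linarith)).2 hp₂)
    ((div_le_iff₀ (by linarith)).2 (by linarith)) (abs_nonneg s) (by positivity : 0 ≤ |y| ^ (p / 2))
  rw [abs_rpow_half_rpow hp] at hmean
  have hslope : tangentSlope p s * y ≤ p * (|s| ^ (2 - 2 / p) * |y|) := by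
    rw [← mul_assoc, ← abs_tangentSlope hp, ← abs_mul]
    exact le_abs_self _
  have hpr : p * (2 / p) = 2 := mul_div_cancel₀ 2 (by linarith)
  rw [← sq_abs_rpow_half p y, ← sq_abs s]
  set σ := |y| ^ (p / 2)
  calc tangentSlope p s * y - (p - 1) * |s| ^ 2
      ≤ p * (σ * ((2 - 2 / p) * |s| + (2 / p - 1) * σ)) - (p - 1) * |s| ^ 2 := by
        exact sub_le_sub_right (hslope.trans (mul_le_mul_of_nonneg_left hmean (by linarith))) _
    _ = σ ^ 2 - (p - 1) * (|s| - σ) ^ 2 := by linear_combination (σ ^ 2 - σ * |s|) * hpr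

lemma le_tangentSlope_mul_sub (hp : 1 < p) (hp₂ : p ≤ 2) {s y : ℝ} (hsy : 0 ≤ s * y) :
    |y| ^ p - (|s| - |y| ^ (p / 2)) ^ 2 ≤ tangentSlope p s * y - (p - 1) * s ^ 2 := by
  have hbernoulli := le_rpow_mul_rpow (r := 2 / p) ((one_le_div (by linarith)).2 hp₂)
    (abs_nonneg s) (by positivity : 0 ≤ |y| ^ (p / 2))
  rw [abs_rpow_half_rpow hp] at hbernoulli
  have hslope : tangentSlope p s * y = p * (|s| ^ (2 - 2 / p) * |y|) := by
    rw [← mul_assoc, ← abs_tangentSlope hp, ← abs_mul, abs_of_nonneg]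
    rw [tangentSlope, mul_right_comm, mul_assoc p]
    positivity
  have hpr : p * (2 / p) = 2 := mul_div_cancel₀ 2 (by linarith)
  rw [← sq_abs_rpow_half p y, ← sq_abs s, hslope]
  set σ := |y| ^ (p / 2)
  calc σ ^ 2 - (|s| - σ) ^ 2
      = p * (|s| * ((1 - 2 / p) * |s| + 2 / p * σ)) - (p - 1) * |s| ^ 2 := by
        linear_combination (|s| ^ 2 - |s| * σ) * hpr
    _ ≤ p * (|s| ^ (2 - 2 / p) * |y|) - (p - 1) * |s| ^ 2 := by gcongr

lemma exp_tangentSlope_mul_sub_le (hp : 1 < p) (hp₂ : p ≤ 2) (s y : ℝ) :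
    Real.exp (tangentSlope p s * y - (p - 1) * s ^ 2) ≤ Real.exp (|y| ^ p) *
      (Real.exp (-(p - 1) * (s - |y| ^ (p / 2)) ^ 2) +
        Real.exp (-(p - 1) * (s + |y| ^ (p / 2)) ^ 2)) := by
  have h := Real.exp_le_exp.2 (tangentSlope_mul_sub_le hp hp₂ s y)
  rw [sub_eq_add_neg _ ((p - 1) * (_ - _) ^ 2), Real.exp_add, ← neg_mul] at h
  refine h.trans (mul_le_mul_of_nonneg_left ?_ (Real.exp_nonneg _))
  rcases abs_cases s with ⟨hs, -⟩ | ⟨hs, -⟩ <;> rw [hs]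
  · exact le_add_of_nonneg_right (Real.exp_nonneg _)
  · rw [← neg_add', neg_sq]
    exact le_add_of_nonneg_left (Real.exp_nonneg _)

lemma integrable_exp_tangentSlope (hp : 1 < p) (hp₂ : p ≤ 2) (y : ℝ) :
    Integrable fun s => Real.exp (tangentSlope p s * y - (p - 1) * s ^ 2) := by
  have hgauss := integrable_exp_neg_mul_sq (sub_pos.2 hp)
  have hmeas := measurable_tangentSlope p
  refine (((hgauss.comp_sub_right (|y| ^ (p / 2))).add (hgauss.comp_add_right
    (|y| ^ (p / 2)))).const_mul (Real.exp (|y| ^ p))).mono' (by fun_prop) (.of_forall fun s => ?_)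
  rw [Real.norm_of_nonneg (Real.exp_nonneg _)]
  exact exp_tangentSlope_mul_sub_le hp hp₂ s y

lemma integral_exp_tangentSlope_le (hp : 1 < p) (hp₂ : p ≤ 2) (y : ℝ) :
    ∫ s, Real.exp (tangentSlope p s * y - (p - 1) * s ^ 2) ≤
      2 * √(π / (p - 1)) * Real.exp (|y| ^ p) := by
  have hgauss := integrable_exp_neg_mul_sq (sub_pos.2 hp)
  have hsub := hgauss.comp_sub_right (|y| ^ (p / 2))
  have hadd := hgauss.comp_add_right (|y| ^ (p / 2))
  refine (integral_mono (integrable_exp_tangentSlope hp hp₂ y) ((hsub.add hadd).const_mul _)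
    (fun s => exp_tangentSlope_mul_sub_le hp hp₂ s y)).trans_eq ?_
  simp only [Pi.add_apply]
  rw [integral_const_mul, integral_add hsub hadd,
    integral_sub_right_eq_self (fun s : ℝ => Real.exp (-(p - 1) * s ^ 2)),
    integral_add_right_eq_self (fun s : ℝ => Real.exp (-(p - 1) * s ^ 2)), integral_gaussian]
  ring

lemma le_integral_exp_tangentSlope (hp : 1 < p) (hp₂ : p ≤ 2) (y : ℝ) :
    Real.exp (|y| ^ p) ≤
      Real.exp 1 * ∫ s, Real.exp (tangentSlope p s * y - (p - 1) * s ^ 2) := by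
  have hint := integrable_exp_tangentSlope hp hp₂ y
  have hσ : 0 ≤ |y| ^ (p / 2) := by positivity
  suffices H : ∃ a, ∀ s ∈ Set.Icc a (a + 1), 0 ≤ s * y ∧ (|s| - |y| ^ (p / 2)) ^ 2 ≤ 1 by
    obtain ⟨a, ha⟩ := H
    have hle (s) (hs : s ∈ Set.Icc a (a + 1)) :
        Real.exp (|y| ^ p - 1) ≤ Real.exp (tangentSlope p s * y - (p - 1) * s ^ 2) :=
      Real.exp_le_exp.2 (by linarith [le_tangentSlope_mul_sub hp hp₂ (ha s hs).1, (ha s hs).2])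
    have h := (setIntegral_ge_of_const_le_real measurableSet_Icc (by simp) hle
      hint.integrableOn).trans
      (setIntegral_le_integral hint (.of_forall fun s => (Real.exp_pos _).le))
    rw [Real.volume_real_Icc, add_sub_cancel_left, max_eq_left zero_le_one, mul_one, Real.exp_sub,
      div_le_iff₀ (Real.exp_pos 1), mul_comm] at h
    exact h
  rcases le_total 0 y with hy | hy
  · refine ⟨|y| ^ (p / 2), fun s hs => ⟨mul_nonneg (hσ.trans hs.1) hy, ?_⟩⟩
    rw [abs_of_nonneg (hσ.trans hs.1)]
    nlinarith [hs.1, hs.2]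
  · refine ⟨-|y| ^ (p / 2) - 1, fun s hs => ?_⟩
    have hs0 : s ≤ 0 := by linarith [hs.2]
    refine ⟨mul_nonneg_of_nonpos_of_nonpos hs0 hy, ?_⟩
    rw [abs_of_nonpos hs0]
    nlinarith [hs.1, hs.2]

lemma exists_measure_exp_abs_rpow (hp : 1 < p) (hp₂ : p ≤ 2) :
    ∃ (ν : Measure ℝ) (_ : IsFiniteMeasure ν) (C : ℝ), ∀ y : ℝ,
      Integrable (fun l => Real.exp (l * y)) ν ∧
      Real.exp (|y| ^ p) ≤ ∫ l, Real.exp (l * y) ∂ν ∧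
      ∫ l, Real.exp (l * y) ∂ν ≤ C * Real.exp (|y| ^ p) := by
  set ρ : ℝ → ℝ≥0∞ := fun s => ENNReal.ofReal (Real.exp (1 - (p - 1) * s ^ 2))
  have hρ_meas : Measurable ρ := by fun_prop
  have hslope := measurable_tangentSlope p
  have hdensity (y s : ℝ) : (ρ s).toReal • Real.exp (tangentSlope p s * y) =
      Real.exp 1 * Real.exp (tangentSlope p s * y - (p - 1) * s ^ 2) := by
    rw [ENNReal.toReal_ofReal (Real.exp_nonneg _), smul_eq_mul, ← Real.exp_add, ← Real.exp_add]
    ring_nf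
  have hint (y : ℝ) : Integrable (fun l => Real.exp (l * y))
      ((volume.withDensity ρ).map (tangentSlope p)) := by
    rw [integrable_map_measure (by fun_prop) hslope.aemeasurable,
      integrable_withDensity_iff_integrable_smul' hρ_meas
        (.of_forall fun s => ENNReal.ofReal_lt_top)]
    simp only [Function.comp_apply, hdensity]
    exact (integrable_exp_tangentSlope hp hp₂ y).const_mul _
  refine ⟨(volume.withDensity ρ).map (tangentSlope p), ?_,
    Real.exp 1 * (2 * √(π / (p - 1))), fun y => ⟨hint y, ?_⟩⟩
  · simpa [integrable_const_iff] using hint 0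
  · rw [integral_map hslope.aemeasurable (by fun_prop), integral_withDensity_eq_integral_toReal_smul
      hρ_meas (.of_forall fun s => ENNReal.ofReal_lt_top)]
    simp only [hdensity]
    rw [integral_const_mul, mul_assoc]
    exact ⟨le_integral_exp_tangentSlope hp hp₂ y, mul_le_mul_of_nonneg_left
      (integral_exp_tangentSlope_le hp hp₂ y) (Real.exp_nonneg 1)⟩

lemma exists_measure_exp_sum_abs_rpow {ι : Type*} [Fintype ι] {p : ι → ℝ}
    (hp : ∀ j, 1 < p j ∧ p j ≤ 2) :
    ∃ (ν : Measure (ι → ℝ)) (_ : IsFiniteMeasure ν) (C : ℝ), ∀ y : ι → ℝ,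
      ENNReal.ofReal (Real.exp (∑ j, |y j| ^ p j)) ≤
        ∫⁻ l, ENNReal.ofReal (Real.exp (l ⬝ᵥ y)) ∂ν ∧
      ∫⁻ l, ENNReal.ofReal (Real.exp (l ⬝ᵥ y)) ∂ν ≤
        ENNReal.ofReal C * ENNReal.ofReal (Real.exp (∑ j, |y j| ^ p j)) := by
  choose ν hν C h using fun j => exists_measure_exp_abs_rpow (hp j).1 (hp j).2
  refine ⟨Measure.pi ν, inferInstance, ∏ j, C j, fun y => ?_⟩
  have hC (j : ι) : 0 ≤ C j := by
    have := (Real.exp_pos _).trans_le ((h j 0).2.1.trans (h j 0).2.2)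
    exact (pos_of_mul_pos_left this (Real.exp_nonneg _)).le
  simp only [dotProduct, Real.exp_sum]
  rw [← ofReal_integral_eq_lintegral_ofReal (.fintype_prod fun j => (h j (y j)).1)
    (.of_forall fun l => by positivity), 
    integral_fintype_prod_eq_prod (fun j l => Real.exp (l * y j)),
    ← ENNReal.ofReal_mul (Finset.prod_nonneg fun j _ => hC j), ← Finset.prod_mul_distrib]
  exact ⟨ENNReal.ofReal_le_ofReal (Finset.prod_le_prod (fun j _ => (Real.exp_nonneg _))
      fun j _ => (h j (y j)).2.1),
    ENNReal.ofReal_le_ofReal (Finset.prod_le_prod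
      (fun j _ => integral_nonneg fun l => Real.exp_nonneg _) fun j _ => (h j (y j)).2.2)⟩

lemma lintegral_mul_le_of_superposition {α β : Type*} [MeasurableSpace α] [MeasurableSpace β]
    {μ : Measure α} {ν : Measure β} [SFinite μ] [SFinite ν] {K : β → α → ℝ≥0∞} {W : α → ℝ≥0∞}
    (hK : Measurable (Function.uncurry K)) {C : ℝ≥0∞}
    (hC : C ≠ ∞) (hW : ∀ x, W x ≤ ∫⁻ s, K s x ∂ν)
    (hWC : ∀ x, ∫⁻ s, K s x ∂ν ≤ C * W x) {F F₀ F₁ : α → ℝ≥0∞} (hF : AEMeasurable F μ)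
    (hF₀ : AEMeasurable F₀ μ) (hF₁ : AEMeasurable F₁ μ) {θ : ℝ}
    (hθ₀ : 0 ≤ θ) (hθ₁ : θ ≤ 1)
    (h : ∀ s, ∫⁻ x, K s x * F x ∂μ ≤
      (∫⁻ x, K s x * F₀ x ∂μ) ^ θ * (∫⁻ x, K s x * F₁ x ∂μ) ^ (1 - θ)) :
    ∫⁻ x, W x * F x ∂μ ≤
      C * ((∫⁻ x, W x * F₀ x ∂μ) ^ θ * (∫⁻ x, W x * F₁ x ∂μ) ^ (1 - θ)) := by
  have hθ' : 0 ≤ 1 - θ := sub_nonneg.2 hθ₁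
  have hmeas {G : α → ℝ≥0∞} (hG : AEMeasurable G μ) :
      AEMeasurable (Function.uncurry fun s x => K s x * G x) (ν.prod μ) :=
    hK.aemeasurable.mul hG.comp_snd
  have hswap {G : α → ℝ≥0∞} (hG : AEMeasurable G μ) :
      ∫⁻ s, ∫⁻ x, K s x * G x ∂μ ∂ν = ∫⁻ x, (∫⁻ s, K s x ∂ν) * G x ∂μ := by
    rw [lintegral_lintegral_swap (hmeas hG)]
    exact lintegral_congr fun x => lintegral_mul_const _ hK.of_uncurry_right
  have hle {G : α → ℝ≥0∞} (hG : AEMeasurable G μ) :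
      ∫⁻ s, ∫⁻ x, K s x * G x ∂μ ∂ν ≤ C * ∫⁻ x, W x * G x ∂μ := by
    rw [hswap hG, ← lintegral_const_mul' _ _ hC]
    exact lintegral_mono fun x => by rw [← mul_assoc]; gcongr; exact hWC x
  calc ∫⁻ x, W x * F x ∂μ ≤ ∫⁻ s, ∫⁻ x, K s x * F x ∂μ ∂ν := by
        rw [hswap hF]; exact lintegral_mono fun x => by gcongr; exact hW x
    _ ≤ ∫⁻ s, (∫⁻ x, K s x * F₀ x ∂μ) ^ θ * (∫⁻ x, K s x * F₁ x ∂μ) ^ (1 - θ) ∂ν :=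
        lintegral_mono h
    _ ≤ (∫⁻ s, ∫⁻ x, K s x * F₀ x ∂μ ∂ν) ^ θ * (∫⁻ s, ∫⁻ x, K s x * F₁ x ∂μ ∂ν) ^ (1 - θ) :=
        ENNReal.lintegral_mul_norm_pow_le (hmeas hF₀).lintegral_prod_right'
          (hmeas hF₁).lintegral_prod_right' hθ₀ hθ' (add_sub_cancel θ 1)
    _ ≤ (C * ∫⁻ x, W x * F₀ x ∂μ) ^ θ * (C * ∫⁻ x, W x * F₁ x ∂μ) ^ (1 - θ) := by
        gcongr <;> exact hle ‹_›
    _ = C * ((∫⁻ x, W x * F₀ x ∂μ) ^ θ * (∫⁻ x, W x * F₁ x ∂μ) ^ (1 - θ)) := by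
        rw [ENNReal.mul_rpow_of_nonneg _ _ hθ₀, ENNReal.mul_rpow_of_nonneg _ _ hθ',
          mul_mul_mul_comm, ← ENNReal.rpow_add_of_nonneg _ _ hθ₀ hθ', add_sub_cancel,
          ENNReal.rpow_one]


lemma eLpNorm_two_mul_sq {α : Type*} [MeasurableSpace α] (μ : Measure α) (w f : α → ℂ) :
    eLpNorm (fun x => w x * f x) 2 μ ^ 2 = ∫⁻ x, ENNReal.ofReal (‖w x‖ ^ 2) * ‖f x‖ₑ ^ 2 ∂μ := by
  have h := eLpNorm_nnreal_pow_eq_lintegral (μ := μ) (f := fun x => w x * f x) (p := 2) two_ne_zero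
  simp only [NNReal.coe_ofNat, ENNReal.coe_ofNat, ENNReal.rpow_two] at h
  rw [h]
  refine lintegral_congr fun x => ?_
  rw [enorm_mul, mul_pow, ENNReal.ofReal_pow (norm_nonneg _), ofReal_norm]

variable {n : ℕ}

lemma expNorm_half_smul_sq (l : Fin n → ℝ) (f : EuclideanSpace ℝ (Fin n) → ℂ) :
    expNorm ((2⁻¹ : ℝ) • l) f ^ 2 =
      ∫⁻ x, ENNReal.ofReal (Real.exp (l ⬝ᵥ x.ofLp)) * ‖f x‖ₑ ^ 2 := by
  rw [expNorm, eLpNorm_two_mul_sq]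
  refine lintegral_congr fun x => ?_
  rw [norm_gauss, sq, ← Real.exp_add, ← two_mul]
  simp [dotProduct, Finset.mul_sum, mul_assoc]

lemma weightedNorm_sq {γ p : Fin n → ℝ} (hγ : ∀ j, 0 ≤ γ j) (hp : ∀ j, p j ≠ 0) (κ : ℝ)
    (f : EuclideanSpace ℝ (Fin n) → ℂ) :
    weightedNorm γ p κ f ^ 2 = ∫⁻ x, ENNReal.ofReal
      (Real.exp (∑ j, |(2 * γ j) ^ (p j)⁻¹ * κ * x j| ^ p j)) * ‖f x‖ₑ ^ 2 := by
  rw [weightedNorm, eLpNorm_two_mul_sq]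
  refine lintegral_congr fun x => ?_
  rw [Complex.norm_real, expWeight, Real.norm_of_nonneg (Real.exp_nonneg _), sq, ← Real.exp_add,
    ← two_mul, Finset.mul_sum]
  congr! 4 with j
  have h2γ : 0 ≤ 2 * γ j := mul_nonneg two_pos.le (hγ j)
  rw [mul_assoc _ κ, abs_mul, Real.mul_rpow (abs_nonneg _) (abs_nonneg _),
    abs_of_nonneg (Real.rpow_nonneg h2γ _), Real.rpow_inv_rpow h2γ (hp j), PiLp.smul_apply,
    smul_eq_mul, mul_assoc]

lemma exists_weightedNorm_le_of_expNorm_le {p : Fin n → ℝ} (hp : ∀ j, 1 < p j ∧ p j ≤ 2) :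
    ∃ c : ℝ, 0 < c ∧ ∀ {γ : Fin n → ℝ}, (∀ j, 0 ≤ γ j) →
      ∀ (κ : ℝ) {f f₀ f₁ : EuclideanSpace ℝ (Fin n) → ℂ}, AEStronglyMeasurable f volume →
      AEStronglyMeasurable f₀ volume → AEStronglyMeasurable f₁ volume →
      ∀ {θ : ℝ}, 0 ≤ θ → θ ≤ 1 →
      (∀ l, expNorm l f ≤ expNorm l f₀ ^ θ * expNorm l f₁ ^ (1 - θ)) →
      weightedNorm γ p κ f ≤ ENNReal.ofReal c *
        (weightedNorm γ p κ f₀ ^ θ * weightedNorm γ p κ f₁ ^ (1 - θ)) := by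
  obtain ⟨ν, _, C, hν⟩ := exists_measure_exp_sum_abs_rpow hp
  have hC : 0 < C := by
    have h := (ENNReal.ofReal_pos.2 (Real.exp_pos _)).trans_le ((hν 0).1.trans (hν 0).2)
    exact ENNReal.ofReal_pos.1 (pos_of_ne_zero (left_ne_zero_of_mul h.ne'))
  refine ⟨√C, Real.sqrt_pos.2 hC, fun {γ} hγ κ {f f₀ f₁} hf hf₀ hf₁ {θ} hθ₀ hθ₁ h => ?_⟩
  have hp₀ (j) : p j ≠ 0 := by linarith [(hp j).1]
  have hcomm (x : ℝ≥0∞) (r : ℝ) : (x ^ 2) ^ r = (x ^ r) ^ 2 := by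
    rw [← ENNReal.rpow_two, ← ENNReal.rpow_two, ← ENNReal.rpow_mul, mul_comm, ENNReal.rpow_mul]
  set m : Fin n → ℝ := fun j => (2 * γ j) ^ (p j)⁻¹ * κ
  have hexp (l : Fin n → ℝ) (g : EuclideanSpace ℝ (Fin n) → ℂ) :
      ∫⁻ x, ENNReal.ofReal (Real.exp (l ⬝ᵥ (m * x.ofLp))) * ‖g x‖ₑ ^ 2 =
        expNorm ((2⁻¹ : ℝ) • (l * m)) g ^ 2 := by
    rw [expNorm_half_smul_sq]
    simp only [dotProduct, Pi.mul_apply, mul_assoc]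
  have hsq : weightedNorm γ p κ f ^ 2 ≤ ENNReal.ofReal C *
      ((weightedNorm γ p κ f₀ ^ 2) ^ θ * (weightedNorm γ p κ f₁ ^ 2) ^ (1 - θ)) := by
    rw [weightedNorm_sq hγ hp₀, weightedNorm_sq hγ hp₀, weightedNorm_sq hγ hp₀]
    refine lintegral_mul_le_of_superposition (μ := volume) (ν := ν) (F := fun x => ‖f x‖ₑ ^ 2)
      (F₀ := fun x => ‖f₀ x‖ₑ ^ 2) (F₁ := fun x => ‖f₁ x‖ₑ ^ 2)
      (W := fun x => ENNReal.ofReal (Real.exp (∑ j, |m j * x j| ^ p j)))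
      (K := fun l x => ENNReal.ofReal (Real.exp (l ⬝ᵥ (m * x.ofLp))))
      (by simp only [dotProduct]; fun_prop) ENNReal.ofReal_ne_top
      (fun x => ?_) (fun x => ?_) (hf.enorm.pow_const 2)
      (hf₀.enorm.pow_const 2) (hf₁.enorm.pow_const 2) hθ₀ hθ₁ fun l => ?_
    · exact (hν (m * x.ofLp)).1
    · exact (hν (m * x.ofLp)).2
    rw [hexp, hexp, hexp, hcomm, hcomm, ← mul_pow]
    exact pow_le_pow_left' (h _) 2
  rw [hcomm, hcomm, ← mul_pow, ← Real.sq_sqrt hC.le, ENNReal.ofReal_pow (Real.sqrt_nonneg _),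
    ← mul_pow] at hsq
  exact (ENNReal.pow_le_pow_left_iff two_ne_zero).1 hsq

end Subordination

section Scaling

lemma eLpNorm_comp_smul {E F : Type*} [NormedAddCommGroup E] [NormedSpace ℝ E] [MeasurableSpace E]
    [BorelSpace E] [FiniteDimensional ℝ E] [NormedAddCommGroup F] (μ : Measure E)
    [μ.IsAddHaarMeasure] (f : E → F) {p : ℝ≥0∞} (hp : p ≠ ∞) {ρ : ℝ} (hρ : ρ ≠ 0) :
    eLpNorm (fun x => f (ρ • x)) p μ =
      ENNReal.ofReal |(ρ ^ finrank ℝ E)⁻¹| ^ (1 / p).toReal * eLpNorm f p μ := by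
  rw [← smul_eq_mul, ← eLpNorm_smul_measure_of_ne_top hp, ← Measure.map_addHaar_smul μ hρ]
  exact ((Homeomorph.smulOfNeZero ρ hρ).measurableEmbedding.eLpNorm_map_measure).symm

variable {n : ℕ} {γ p : Fin n → ℝ}

lemma weightedNorm_congr {f g : EuclideanSpace ℝ (Fin n) → ℂ} (h : ∀ᵐ x, ‖f x‖ = ‖g x‖) (κ : ℝ) :
    weightedNorm γ p κ f = weightedNorm γ p κ g :=
  eLpNorm_congr_norm_ae (h.mono fun x hx => by rw [norm_mul, norm_mul, hx])

lemma weightedNorm_of_norm_comp_smul {f g : EuclideanSpace ℝ (Fin n) → ℂ} {ρ : ℝ} (hρ : ρ ≠ 0)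
    (h : ∀ᵐ x, ‖g (ρ • x)‖ = |ρ| ^ (-(n / 2) : ℝ) * ‖f x‖) (κ : ℝ) :
    weightedNorm γ p κ g = weightedNorm γ p (κ * ρ) f := by
  set c : ℝ := |ρ| ^ (-(n / 2) : ℝ) with hc
  have hc₀ : 0 < c := by positivity
  have hjac : ENNReal.ofReal |(ρ ^ finrank ℝ (EuclideanSpace ℝ (Fin n)))⁻¹| ^
      (1 / 2 : ℝ≥0∞).toReal = ‖(c : ℂ)‖ₑ := by
    rw [← ofReal_norm, Complex.norm_real, Real.norm_of_nonneg hc₀.le, finrank_euclideanSpace_fin,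
      ENNReal.ofReal_rpow_of_nonneg (abs_nonneg _) ENNReal.toReal_nonneg, abs_inv, abs_pow,
      ← Real.rpow_natCast, ← Real.rpow_neg (abs_nonneg _), ← Real.rpow_mul (abs_nonneg _), hc]
    norm_num
    ring_nf
  have hg := eLpNorm_comp_smul volume (fun x => (expWeight γ p (κ • x) : ℂ) * g x)
    ENNReal.ofNat_ne_top hρ (p := 2)
  have hf := eLpNorm_const_smul (c : ℂ) (fun x => (expWeight γ p ((κ * ρ) • x) : ℂ) * f x) 2 volume
  have hfg : eLpNorm (fun x => (expWeight γ p (κ • ρ • x) : ℂ) * g (ρ • x)) 2 volume =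
      eLpNorm ((c : ℂ) • fun x => (expWeight γ p ((κ * ρ) • x) : ℂ) * f x) 2 volume := by
    refine eLpNorm_congr_norm_ae (h.mono fun x hx => ?_)
    rw [norm_mul, hx, Pi.smul_apply, norm_smul, norm_mul, Complex.norm_real c,
      Real.norm_of_nonneg hc₀.le, smul_smul]
    ring
  rw [hg, hf, hjac] at hfg
  exact (ENNReal.mul_right_inj (by simpa using hc₀.ne') enorm_ne_top).1 hfg

lemma weightedNorm_fourierHat (κ : ℝ) (f : L2Space n) :
    weightedNorm γ p κ (fourierHat f) = weightedNorm γ p (κ * (2 * π)) (𝓕 f : L2Space n) := by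
  refine weightedNorm_of_norm_comp_smul (by positivity) (.of_forall fun x => ?_) κ
  rw [fourierHat, inv_smul_smul₀ (by positivity), norm_mul, Complex.norm_real,
    Real.norm_of_nonneg (by positivity), abs_of_pos (by positivity), neg_div]

variable {α β t : ℝ}

lemma weightedNorm_freeFlow (hα : α ≠ 0) (ht : α * t + β ≠ 0) (f : L2Space n) :
    weightedNorm γ p (1 / (α * t + β)) (freeFlow t f) = weightedNorm γ p (4 * π / α)
      (𝓕 (chirp (α / 4 * (α * t + β)⁻¹) (freeFlow (-(β / α)) f)) : L2Space n) := by
  have hs_eq : β / α + t = (α * t + β) / α := by field_simp; ring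
  have hs : β / α + t ≠ 0 := hs_eq ▸ div_ne_zero ht hα
  have hκ : 1 / (α * t + β) * (4 * π * (β / α + t)) = 4 * π / α := by rw [hs_eq]; field_simp
  have hσ : (4 * (β / α + t))⁻¹ = α / 4 * (α * t + β)⁻¹ := by rw [hs_eq]; field_simp
  have hf : freeFlow t f = freeFlow (β / α + t) (freeFlow (-(β / α)) f) := by
    rw [freeFlow_freeFlow]; ring_nf
  rw [hf, weightedNorm_of_norm_comp_smul (by positivity) (norm_freeFlow_smul hs _), hκ, hσ]

lemma weightedNorm_fourierHat_eq_chirp_zero (s : ℝ) (f : L2Space n) :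
    weightedNorm γ p (2 / α) (fourierHat f) =
      weightedNorm γ p (4 * π / α) (𝓕 (chirp 0 (freeFlow s f)) : L2Space n) := by
  rw [weightedNorm_fourierHat, chirp_zero, fourier_freeFlow,
    weightedNorm_congr (norm_coeFn_chirp _ _)]
  ring_nf

end Scaling

section Solution

lemma norm_exp_I_mul_sub_one_sub_le (x : ℝ) :
    ‖Complex.exp (Complex.I * x) - 1 - Complex.I * x‖ ≤ 2 * x ^ 2 := by
  have hnorm : ‖Complex.I * (x : ℂ)‖ = |x| := by simp
  rcases le_total |x| 1 with h | h
  · refine (Complex.norm_exp_sub_one_sub_id_le (by rwa [hnorm])).trans ?_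
    rw [hnorm, sq_abs]
    nlinarith [sq_nonneg x]
  · refine (norm_sub_le _ _).trans ?_
    have := Real.norm_exp_I_mul_ofReal_sub_one_le (x := x)
    rw [Real.norm_eq_abs] at this
    rw [hnorm]
    nlinarith [sq_abs x]

lemma hasDerivAt_inner_of_continuousAt {𝕜 E : Type*} [RCLike 𝕜] [NormedAddCommGroup E]
    [InnerProductSpace 𝕜 E] [NormedSpace ℝ E] [IsScalarTower ℝ 𝕜 E] {v w : ℝ → E} {v' : E} {c : 𝕜}
    {t : ℝ} (hv : HasDerivAt v v' t) (hw : ContinuousAt w t)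
    (h : HasDerivAt (fun s => inner 𝕜 (v t) (w s)) c t) :
    HasDerivAt (fun s => inner 𝕜 (v s) (w s)) (inner 𝕜 v' (w t) + c) t := by
  rw [hasDerivAt_iff_tendsto_slope] at hv h ⊢
  refine ((hv.inner (𝕜 := 𝕜) (hw.tendsto.mono_left nhdsWithin_le_nhds)).add h).congr fun s => ?_
  simp only [slope_def_module]
  rw [← algebraMap_smul 𝕜 (s - t)⁻¹ (v s - v t), inner_smul_left, inner_sub_left]
  simp only [RCLike.algebraMap_eq_ofReal, RCLike.conj_ofReal, RCLike.real_smul_eq_coe_mul]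
  ring

lemma eq_of_hasDerivAt_zero {F : Type*} [NormedAddCommGroup F] [NormedSpace ℝ F] {g : ℝ → F}
    {a : ℝ} (hg : ContinuousOn g (Set.Ici a)) (hg' : ∀ s, a < s → HasDerivAt g 0 s) {t : ℝ}
    (ht : a ≤ t) : g t = g a := by
  obtain ⟨c, hc⟩ := isOpen_Ioi.exists_is_const_of_deriv_eq_zero isPreconnected_Ioi
    (fun s hs => (hg' s hs).differentiableAt.differentiableWithinAt) fun s hs => (hg' s hs).deriv
  have h : Set.EqOn g (fun _ => c) (Set.Ici a) :=
    Set.EqOn.of_subset_closure hc hg continuousOn_const Set.Ioi_subset_Ici_self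
      (closure_Ioi a).ge
  exact (h ht).trans (h Set.self_mem_Ici).symm

variable {n : ℕ}

lemma contDiff_gauss (a : ℂ) (b : Fin n → ℂ) : ContDiff ℝ (⊤ : ℕ∞) (gauss a b) := by
  have hnorm : ContDiff ℝ (⊤ : ℕ∞) fun x : EuclideanSpace ℝ (Fin n) => ((‖x‖ ^ 2 : ℝ) : ℂ) :=
    Complex.ofRealCLM.contDiff.comp (contDiff_norm_sq ℝ)
  have hcoord (i : Fin n) :
      ContDiff ℝ (⊤ : ℕ∞) fun x : EuclideanSpace ℝ (Fin n) => ((x i : ℝ) : ℂ) :=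
    Complex.ofRealCLM.contDiff.comp (EuclideanSpace.proj (𝕜 := ℝ) i).contDiff
  simp only [Complex.ofReal_pow] at hnorm
  unfold gauss
  fun_prop

lemma gauss_neg_mul_I (σ : ℝ) (x : EuclideanSpace ℝ (Fin n)) :
    gauss (-(σ * Complex.I)) 0 x = Complex.exp (Complex.I * (σ * ‖x‖ ^ 2 : ℝ)) := by
  rw [gauss]
  simp only [Pi.zero_apply, zero_mul, Finset.sum_const_zero, add_zero]
  push_cast
  congr 1
  ring

lemma inner_chirp_left (σ : ℝ) (f g : L2Space n) :
    inner ℂ (chirp σ f) g = inner ℂ f (chirp (-σ) g) := by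
  rw [L2.inner_def, L2.inner_def]
  refine integral_congr_ae ?_
  filter_upwards [coeFn_chirp σ f, coeFn_chirp (-σ) g] with x hf hg
  rw [hf, hg, gauss_neg_mul_I, gauss_neg_mul_I]
  simp only [RCLike.inner_apply, map_mul, ← Complex.exp_conj, Complex.conj_I, Complex.conj_ofReal]
  push_cast
  ring_nf

lemma norm_chirp_sub_sub_le {f g k : L2Space n}
    (hg : g =ᵐ[volume] fun x => Complex.I * ‖x‖ ^ 2 * f x)
    (hk : k =ᵐ[volume] fun x => (‖x‖ : ℂ) ^ 4 * f x) (σ τ : ℝ) :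
    ‖chirp τ f - chirp σ f - (τ - σ) • chirp σ g‖ ≤ 2 * ‖k‖ * (τ - σ) ^ 2 := by
  rw [mul_right_comm]
  refine Lp.norm_le_mul_norm_of_ae_le_mul ?_
  filter_upwards [Lp.coeFn_sub (chirp τ f - chirp σ f) ((τ - σ) • chirp σ g),
    Lp.coeFn_sub (chirp τ f) (chirp σ f), Lp.coeFn_smul (τ - σ) (chirp σ g), coeFn_chirp τ f,
    coeFn_chirp σ f, coeFn_chirp σ g, hg, hk] with x h₁ h₂ h₃ hτ hσ hσg hg hk
  have hphase : gauss (-(τ * Complex.I)) 0 x = gauss (-(σ * Complex.I)) 0 x *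
      Complex.exp (Complex.I * ((τ - σ) * ‖x‖ ^ 2 : ℝ)) := by
    rw [← gauss_neg_mul_I, ← gauss_add]
    push_cast
    ring_nf
  have hfactor : gauss (-(τ * Complex.I)) 0 x * f x - gauss (-(σ * Complex.I)) 0 x * f x -
      (τ - σ) • (gauss (-(σ * Complex.I)) 0 x * (Complex.I * ‖x‖ ^ 2 * f x)) =
      gauss (-(σ * Complex.I)) 0 x * f x * (Complex.exp (Complex.I * ((τ - σ) * ‖x‖ ^ 2 : ℝ)) - 1 -
        Complex.I * ((τ - σ) * ‖x‖ ^ 2 : ℝ)) := by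
    rw [hphase, Complex.real_smul]
    push_cast
    ring
  rw [h₁, Pi.sub_apply, h₂, Pi.sub_apply, h₃, Pi.smul_apply, hτ, hσ, hσg, hg, hk, hfactor, norm_mul,
    norm_mul, norm_mul, norm_pow, Complex.norm_real, norm_norm]
  calc
    _ ≤ 1 * ‖f x‖ * (2 * ((τ - σ) * ‖x‖ ^ 2) ^ 2) := by
      gcongr
      · simp [norm_gauss]
      · exact norm_exp_I_mul_sub_one_sub_le _
    _ = _ := by ring

lemma hasDerivAt_chirp {f g k : L2Space n}
    (hg : g =ᵐ[volume] fun x => Complex.I * ‖x‖ ^ 2 * f x)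
    (hk : k =ᵐ[volume] fun x => (‖x‖ : ℂ) ^ 4 * f x) (σ : ℝ) :
    HasDerivAt (fun τ => chirp τ f) (chirp σ g) σ := by
  rw [hasDerivAt_iff_isLittleO]
  refine Asymptotics.IsBigO.trans_isLittleO ?_ (Asymptotics.isLittleO_pow_sub_sub σ one_lt_two)
  refine .of_bound (2 * ‖k‖) (.of_forall fun τ => ?_)
  simpa using norm_chirp_sub_sub_le hg hk σ τ

namespace IsFreeSchrodingerSolution

variable {u : ℝ → L2Space n}

lemma continuousOn_fourier (hu : IsFreeSchrodingerSolution u) :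
    ContinuousOn (fun s => (𝓕 (u s) : L2Space n)) (Set.Ici 0) :=
  (Lp.fourierTransformₗᵢ (EuclideanSpace ℝ (Fin n)) ℂ).continuous.comp_continuousOn hu.continuousOn

lemma hasDerivAt_integral_fourier (hu : IsFreeSchrodingerSolution u) {t : ℝ} (ht : 0 < t)
    (φ : 𝓢(EuclideanSpace ℝ (Fin n), ℂ)) :
    HasDerivAt (fun s => ∫ ξ, φ ξ * (𝓕 (u s) : L2Space n) ξ)
      (-(4 * π ^ 2 * Complex.I) * ∫ ξ, ‖ξ‖ ^ 2 * φ ξ * (𝓕 (u t) : L2Space n) ξ) t := by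
  have hpair (f : L2Space n) (φ : 𝓢(EuclideanSpace ℝ (Fin n), ℂ)) :
      Lp.toTemperedDistribution f (𝓕 φ) = ∫ ξ, φ ξ * (𝓕 f : L2Space n) ξ := by
    rw [← TemperedDistribution.fourier_apply, Lp.fourier_toTemperedDistribution_eq,
      Lp.toTemperedDistribution_apply]
    rfl
  have hgrowth : (fun x : EuclideanSpace ℝ (Fin n) => ((‖x‖ ^ 2 : ℝ) : ℂ)).HasTemperateGrowth := by
    fun_prop
  have hlaplacian : Δ (Lp.toTemperedDistribution (u t)) (𝓕 φ) =
      -(4 * π ^ 2) * ∫ ξ, ‖ξ‖ ^ 2 * φ ξ * (𝓕 (u t) : L2Space n) ξ := by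
    rw [TemperedDistribution.laplacian_eq_fourierMultiplierCLM]
    rw [← Complex.coe_smul, _root_.smul_apply,
      TemperedDistribution.fourierMultiplierCLM_apply_apply,
      FourierTransform.fourierInv_fourier_eq, hpair]
    simp only [SchwartzMap.smulLeftCLM_apply_apply hgrowth]
    simp only [smul_eq_mul, Complex.ofReal_neg, Complex.ofReal_pow, Complex.ofReal_mul,
      Complex.ofReal_ofNat, mul_pow]
    norm_num
  convert hu.hasDerivAt t ht (𝓕 φ) using 1
  · exact funext fun s => (hpair (u s) φ).symm
  · rw [hlaplacian]
    ring

lemma hasDerivAt_inner_fourier (hu : IsFreeSchrodingerSolution u) {t : ℝ} (ht : 0 < t)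
    {ψ : EuclideanSpace ℝ (Fin n) → ℂ} (hψ : ContDiff ℝ (⊤ : ℕ∞) ψ) (hψc : HasCompactSupport ψ)
    {f g : L2Space n} (hf : f =ᵐ[volume] ψ) (hg : g =ᵐ[volume] fun x => Complex.I * ‖x‖ ^ 2 * f x) :
    HasDerivAt (fun s => inner ℂ f (𝓕 (u s) : L2Space n))
      (4 * π ^ 2 * inner ℂ g (𝓕 (u t) : L2Space n)) t := by
  let φ : 𝓢(EuclideanSpace ℝ (Fin n), ℂ) :=
    (hψc.comp_left (g := starRingEnd ℂ) (map_zero _)).toSchwartzMap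
      (Complex.conjCLE.contDiff.comp hψ)
  have hφ (x : EuclideanSpace ℝ (Fin n)) : φ x = starRingEnd ℂ (ψ x) := rfl
  convert hu.hasDerivAt_integral_fourier ht φ using 1
  · ext s
    rw [L2.inner_def]
    refine integral_congr_ae ?_
    filter_upwards [hf] with x hx
    rw [hx, hφ, RCLike.inner_apply, mul_comm]
  · rw [L2.inner_def, ← integral_const_mul, ← integral_const_mul]
    refine integral_congr_ae ?_
    filter_upwards [hf, hg] with x hfx hgx
    simp only [hgx, hfx, hφ, RCLike.inner_apply, map_mul, Complex.conj_I, map_pow,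
      Complex.conj_ofReal]
    ring

lemma hasDerivAt_inner_chirp_fourier (hu : IsFreeSchrodingerSolution u) {t : ℝ} (ht : 0 < t)
    {ψ : EuclideanSpace ℝ (Fin n) → ℂ} (hψ : ContDiff ℝ (⊤ : ℕ∞) ψ) (hψc : HasCompactSupport ψ)
    {f g : L2Space n} (hf : f =ᵐ[volume] ψ) (hg : g =ᵐ[volume] fun x => Complex.I * ‖x‖ ^ 2 * f x)
    (σ : ℝ) :
    HasDerivAt (fun s => inner ℂ (chirp σ f) (𝓕 (u s) : L2Space n))
      (4 * π ^ 2 * inner ℂ (chirp σ g) (𝓕 (u t) : L2Space n)) t := by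
  refine hu.hasDerivAt_inner_fourier ht ((contDiff_gauss (-(σ * Complex.I)) 0).mul hψ)
    hψc.mul_left ?_ ?_
  · filter_upwards [coeFn_chirp σ f, hf] with x h₁ h₂
    rw [h₁, h₂]
  · filter_upwards [coeFn_chirp σ f, coeFn_chirp σ g, hg] with x h₁ h₂ h₃
    rw [h₁, h₂, h₃, mul_left_comm]

lemma inner_chirp_eq (hu : IsFreeSchrodingerSolution u) {t : ℝ} (ht : 0 ≤ t)
    {ψ : EuclideanSpace ℝ (Fin n) → ℂ} (hψ : ContDiff ℝ (⊤ : ℕ∞) ψ) (hψc : HasCompactSupport ψ)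
    {f : L2Space n} (hf : f =ᵐ[volume] ψ) :
    inner ℂ (chirp (-(4 * π ^ 2 * t)) f) (𝓕 (u t) : L2Space n) =
      inner ℂ f (𝓕 (u 0) : L2Space n) := by
  have hmul {k : EuclideanSpace ℝ (Fin n) → ℂ} (hk : Continuous k) :
      ∃ g : L2Space n, g =ᵐ[volume] fun x => k x * f x := by
    have hmem : MemLp (fun x => k x * ψ x) 2 volume :=
      (hk.mul hψ.continuous).memLp_of_hasCompactSupport hψc.mul_left
    exact ⟨hmem.toLp, hmem.coeFn_toLp.trans (hf.mono fun x hx => by simp only [hx])⟩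
  obtain ⟨g, hg⟩ := hmul (k := fun x => Complex.I * ‖x‖ ^ 2) (by fun_prop)
  obtain ⟨k, hk⟩ := hmul (k := fun x => (‖x‖ : ℂ) ^ 4) (by fun_prop)
  have hflow (s : ℝ) : HasDerivAt (fun s => chirp (-(4 * π ^ 2 * s)) f)
      ((-(4 * π ^ 2)) • chirp (-(4 * π ^ 2 * s)) g) s :=
    (hasDerivAt_chirp hg hk _).scomp s
      (by simpa using ((hasDerivAt_id' s).const_mul (4 * π ^ 2)).fun_neg)
  have hderiv (s : ℝ) (hs : 0 < s) : HasDerivAt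
      (fun s => inner ℂ (chirp (-(4 * π ^ 2 * s)) f) (𝓕 (u s) : L2Space n)) 0 s := by
    refine (hasDerivAt_inner_of_continuousAt (hflow s)
      (hu.continuousOn_fourier.continuousAt (Ici_mem_nhds hs))
      (hu.hasDerivAt_inner_chirp_fourier hs hψ hψc hf hg _)).congr_deriv ?_
    rw [inner_smul_left_eq_smul, Complex.real_smul]
    push_cast
    ring
  have hcont : ContinuousOn
      (fun s => inner ℂ (chirp (-(4 * π ^ 2 * s)) f) (𝓕 (u s) : L2Space n)) (Set.Ici 0) :=
    ContinuousOn.inner (𝕜 := ℂ) (fun s _ => (hflow s).continuousAt.continuousWithinAt)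
      hu.continuousOn_fourier
  simpa [chirp_zero] using eq_of_hasDerivAt_zero hcont hderiv ht

theorem eq_freeFlow (hu : IsFreeSchrodingerSolution u) {t : ℝ} (ht : 0 ≤ t) :
    u t = freeFlow t (u 0) := by
  have h : chirp (4 * π ^ 2 * t) (𝓕 (u t)) = 𝓕 (u 0) := by
    refine Lp.ext (ae_eq_of_integral_contDiff_smul_eq
      ((Lp.memLp _).locallyIntegrable one_le_two) ((Lp.memLp _).locallyIntegrable one_le_two)
      fun ψ hψ hψc => ?_)
    have hψ' : ContDiff ℝ (⊤ : ℕ∞) fun x => (ψ x : ℂ) := Complex.ofRealCLM.contDiff.comp hψ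
    have hψc' : HasCompactSupport fun x => (ψ x : ℂ) := hψc.comp_left Complex.ofReal_zero
    have hmem : MemLp (fun x => (ψ x : ℂ)) 2 volume :=
      hψ'.continuous.memLp_of_hasCompactSupport hψc'
    have hinner (g : L2Space n) : inner ℂ hmem.toLp g = ∫ x, ψ x • g x := by
      rw [L2.inner_def]
      refine integral_congr_ae (hmem.coeFn_toLp.mono fun x hx => ?_)
      simp [hx, mul_comm]
    rw [← hinner, ← hinner, ← hu.inner_chirp_eq ht hψ' hψc' hmem.coeFn_toLp, inner_chirp_left,
      neg_neg]
  rw [freeFlow, ← h, chirp_chirp, neg_add_cancel, chirp_zero,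
    FourierTransform.fourierInv_fourier_eq]

end IsFreeSchrodingerSolution

end Solution

section Interpolation

lemma exists_weightedNorm_fourier_chirp_le {n : ℕ} {p : Fin n → ℝ}
    (hp : ∀ j, 1 < p j ∧ p j ≤ 2) :
    ∃ c : ℝ, 0 < c ∧ ∀ {γ : Fin n → ℝ}, (∀ j, 0 ≤ γ j) → ∀ (κ : ℝ) (v : L2Space n)
      {σ σ₀ σ₁ θ : ℝ}, 0 ≤ θ → θ ≤ 1 → σ = θ * σ₀ + (1 - θ) * σ₁ →
      weightedNorm γ p κ (𝓕 (chirp σ v) : L2Space n) ≤ ENNReal.ofReal c *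
        (weightedNorm γ p κ (𝓕 (chirp σ₀ v) : L2Space n) ^ θ *
          weightedNorm γ p κ (𝓕 (chirp σ₁ v) : L2Space n) ^ (1 - θ)) := by
  obtain ⟨c, hc, hle⟩ := exists_weightedNorm_le_of_expNorm_le hp
  refine ⟨c, hc, fun {γ} hγ κ v {σ σ₀ σ₁ θ} hθ₀ hθ₁ hσ => ?_⟩
  exact hle hγ κ (Lp.aestronglyMeasurable _) (Lp.aestronglyMeasurable _)
    (Lp.aestronglyMeasurable _) hθ₀ hθ₁ fun l => hσ ▸ expNorm_fourier_chirp_le v l σ₀ σ₁ hθ₀ hθ₁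

variable {α β T t : ℝ}

lemma thetaExp_mem_Icc (hα : 0 ≤ α) (hβ : 0 < β) (hT : 0 < T) (ht : 0 ≤ t) (htT : t ≤ T) :
    thetaExp α β T t ∈ Set.Icc 0 1 := by
  rw [thetaExp]
  refine ⟨div_nonneg (mul_nonneg hβ.le (sub_nonneg.2 htT)) (by positivity), ?_⟩
  rw [div_le_one (by positivity)]
  nlinarith [mul_nonneg (mul_nonneg hα hT.le) ht, mul_nonneg hβ.le ht]

lemma inv_eq_thetaExp_mul_add (hβ : β ≠ 0) (hT : T ≠ 0) (ht : α * t + β ≠ 0)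
    (hαT : α * T + β ≠ 0) :
    (α * t + β)⁻¹ = thetaExp α β T t * β⁻¹ + (1 - thetaExp α β T t) * (α * T + β)⁻¹ := by
  rw [thetaExp]
  field_simp
  ring

lemma muExp_mem_Icc (hα : 0 ≤ α) (hβ : 0 < β) (ht : 0 ≤ t) : muExp α β t ∈ Set.Icc 0 1 := by
  rw [muExp]
  exact ⟨by positivity, div_le_one_of_le₀ (le_add_of_nonneg_left (by positivity)) (by positivity)⟩

lemma inv_eq_muExp_mul (hβ : β ≠ 0) : (α * t + β)⁻¹ = muExp α β t * β⁻¹ := by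
  rw [muExp]
  field_simp

end Interpolation

theorem corollary3p2 (n : ℕ) (p : Fin n → ℝ) (hp : ∀ j, 1 < p j ∧ p j ≤ 2) :
    ∃ c : ℝ, 0 < c ∧
      ∀ (γ : Fin n → ℝ), (∀ j, 0 ≤ γ j) →
      ∀ (α β : ℝ), 0 < α → 0 < β →
      ∀ u : ℝ → L2Space n, IsFreeSchrodingerSolution u →
        (∀ T t : ℝ, 0 < T → 0 ≤ t → t ≤ T →
          weightedNorm γ p (1 / (α * t + β)) (u t) ≤
            ENNReal.ofReal c *
              (weightedNorm γ p (1 / β) (u 0) ^ thetaExp α β T t *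
                weightedNorm γ p (1 / (α * T + β)) (u T) ^ (1 - thetaExp α β T t))) ∧
        (∀ t : ℝ, 0 ≤ t →
          weightedNorm γ p (1 / (α * t + β)) (u t) ≤
            ENNReal.ofReal c *
              (weightedNorm γ p (1 / β) (u 0) ^ muExp α β t *
                weightedNorm γ p (2 / α) (fourierHat (u 0)) ^ (1 - muExp α β t))) := by
  obtain ⟨c, hc, hinterp⟩ := exists_weightedNorm_fourier_chirp_le hp
  refine ⟨c, hc, fun γ hγ α β hα hβ u hu => ?_⟩
  have hnorm {t : ℝ} (ht : 0 ≤ t) : weightedNorm γ p (1 / (α * t + β)) (u t) =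
      weightedNorm γ p (4 * π / α)
        (𝓕 (chirp (α / 4 * (α * t + β)⁻¹) (freeFlow (-(β / α)) (u 0))) : L2Space n) := by
    rw [hu.eq_freeFlow ht, weightedNorm_freeFlow hα.ne' (by positivity)]
  have hnorm₀ := hnorm le_rfl
  rw [mul_zero, zero_add] at hnorm₀
  refine ⟨fun T t hT ht htT => ?_, fun t ht => ?_⟩
  · obtain ⟨hθ₀, hθ₁⟩ := thetaExp_mem_Icc hα.le hβ hT ht htT
    rw [hnorm ht, hnorm₀, hnorm hT.le]
    refine hinterp hγ _ _ hθ₀ hθ₁ ?_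
    rw [inv_eq_thetaExp_mul_add (T := T) hβ.ne' hT.ne' (by positivity) (by positivity)]
    ring
  · obtain ⟨hμ₀, hμ₁⟩ := muExp_mem_Icc hα.le hβ ht
    rw [hnorm ht, hnorm₀, weightedNorm_fourierHat_eq_chirp_zero (-(β / α))]
    refine hinterp hγ _ _ hμ₀ hμ₁ ?_
    rw [inv_eq_muExp_mul hβ.ne']
    ring
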